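/- Let $d,K\in\mathbb N$ with $K\ge d$, and let $I$ denote the unit mass at the origin of $\mathbb R^d$. Let $F$ be a probability distribution on $\mathbb R^d$ such that the following assumptions hold. (1) $F=qI+\sum_{m=1}^K p_mF_m$, where $q,p_1,\dots,p_K\in(0,1)$, $\sum_{m=1}^Kp_m=1-q$, and $F_1,\dots,F_K$ are probability distributions on $\mathbb R^d$. (2) There are non-zero vectors $y_1,\dots,y_K\in\mathbb R^d$ such that $\operatorname{supp}F_m\subset\{ky_m: k\in\mathbb Z\setminus\{0\}\}$ for all $m$, and $\operatorname{supp}F_m\cap\operatorname{supp}F_k=\emptyset$ for $k\neq m$. (3) All $\operatorname{supp}F_m$ are non-empty, and the $F_m$ are symmetric: $F_m\{ky_m\}=F_m\{-ky_m\}$ for $k=1,2,\dots$ and $m=1,\dots,K$. (4) For every $m$ there is an integer $k_m^0$ with $F_m\{k^0_my_m\}>0$ and $F_m\{(k^0_m+1)y_m\}>0$. Put $\sigma_m=\bigl(\sum_{k\in\mathbb Z}k^2F_m\{ky_m\}\bigr)^{1/2}\in[0,\infty]$. For a finite signed Borel measure $M$ on $\mathbb R^d$ let $\exp\{M\}=\sum_{j\ge0}M^{*j}/j!$,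 where $M^{*j}$ is the $j$-fold convolution power and $M^{*0}=I$; thus, for $\lambda>0$, $\exp\{\lambda(F-I)\}$ is the compound Poisson distribution with parameter $\lambda$ and compounding distribution $F$. Let $\mathrm d(G,H)=\sup_B|G\{B\}-H\{B\}|$, the supremum being over all Borel sets $B\subset\mathbb R^d$, denote the total variation distance. Then, for all $a,b>0$, $$\mathrm d\bigl(\exp\{a(F-I)\},\exp\{b(F-I)\}\bigr)\le\frac{1.7\,|b-a|}{\max(a,b)}\sum_{m=1}^K\sqrt{1+\sigma_m},$$ where the right-hand side is $+\infty$ if some $\sigma_m=\infty$ and $a\ne b$, and is $0$ if $a=b$. -/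

import Mathlib

open MeasureTheory
open scoped ENNReal

/-! Finite signed measures, their convolution, and the exponential of a signed measure. -/

/-- A signed measure has finite total variation; this guarantees that products of signed measures
exist. -/
instance signedMeasure_isFiniteMeasure_variation {X : Type*} [MeasurableSpace X]
    (M : SignedMeasure X) : IsFiniteMeasure (VectorMeasure.variation M) := by
  rw [← SignedMeasure.totalVariation_eq_variation]
  infer_instance

/-- The convolution `M * V` of two signed measures: the image under addition of the product measure
`M ⊗ V`. -/
noncomputable def signedConv {E : Type*} [AddMonoid E] [MeasurableSpace E] [MeasurableAdd₂ E]
    (M V : SignedMeasure E) : SignedMeasure E :=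
  (VectorMeasure.prod M V (ContinuousLinearMap.mul ℝ ℝ)).map (fun p : E × E => p.1 + p.2)

/-- The convolution powers of a signed measure; the zeroth power is the unit mass at the origin. -/
noncomputable def signedConvPow {E : Type*} [AddMonoid E] [MeasurableSpace E] [MeasurableAdd₂ E]
    (M : SignedMeasure E) : ℕ → SignedMeasure E
  | 0 => (Measure.dirac (0 : E)).toSignedMeasure
  | j + 1 => signedConv (signedConvPow M j) M

theorem signedConv_variation_univ_le {E : Type*} [AddMonoid E] [MeasurableSpace E]
    [MeasurableAdd₂ E] (M V : SignedMeasure E) :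
    VectorMeasure.variation (signedConv M V) Set.univ ≤
      VectorMeasure.variation M Set.univ * VectorMeasure.variation V Set.univ := by
  unfold signedConv
  refine (VectorMeasure.variation_map_le (φ := fun p : E × E => p.1 + p.2) _).trans ?_
  rw [Measure.map_apply measurable_add MeasurableSet.univ, Set.preimage_univ]
  refine (VectorMeasure.variation_prod_le _).trans ?_
  have h1 : ‖ContinuousLinearMap.mul ℝ ℝ‖ₑ = 1 := by
    rw [← ofReal_norm, ContinuousLinearMap.opNorm_mul, ENNReal.ofReal_one]
  rw [h1, one_smul, ← Set.univ_prod_univ, Measure.prod_prod]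

theorem signedConvPow_variation_univ_le {E : Type*} [AddMonoid E] [MeasurableSpace E]
    [MeasurableAdd₂ E] (M : SignedMeasure E) (j : ℕ) :
    VectorMeasure.variation (signedConvPow M j) Set.univ ≤
      VectorMeasure.variation M Set.univ ^ j := by
  induction j with
  | zero => simp [signedConvPow]
  | succ j ih =>
    rw [pow_succ]
    exact (signedConv_variation_univ_le _ _).trans (mul_le_mul_left ih _)

theorem signedConvPow_real_variation_univ_le {E : Type*} [AddMonoid E] [MeasurableSpace E]
    [MeasurableAdd₂ E] (M : SignedMeasure E) (j : ℕ) :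
    (VectorMeasure.variation (signedConvPow M j)).real Set.univ ≤
      (VectorMeasure.variation M).real Set.univ ^ j := by
  rw [measureReal_def, measureReal_def, ← ENNReal.toReal_pow]
  exact ENNReal.toReal_mono (ENNReal.pow_ne_top (measure_ne_top _ _))
    (signedConvPow_variation_univ_le M j)

/-- The terms of the exponential series evaluated on a set are dominated by those of an ordinary
exponential series. -/
theorem signedExp_summable_bound {E : Type*} [AddMonoid E] [MeasurableSpace E]
    [MeasurableAdd₂ E] (M : SignedMeasure E) :
    Summable fun j : ℕ => ((j.factorial : ℝ))⁻¹ *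
      (VectorMeasure.variation (signedConvPow M j)).real Set.univ := by
  refine Summable.of_nonneg_of_le (fun j => by positivity) (fun j => ?_)
    (Real.summable_pow_div_factorial ((VectorMeasure.variation M).real Set.univ))
  rw [div_eq_inv_mul]
  gcongr
  exact signedConvPow_real_variation_univ_le M j

/-- A series of signed measures whose total variations are summable is countably additive. -/
theorem signedMeasure_series_hasSum_iUnion {E : Type*} [MeasurableSpace E]
    (c : ℕ → ℝ) (hc0 : ∀ j, 0 ≤ c j) (N : ℕ → SignedMeasure E)
    (hb : Summable fun j => c j * (VectorMeasure.variation (N j)).real Set.univ)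
    (f : ℕ → Set E) (hf : ∀ i, MeasurableSet (f i))
    (hd : Pairwise (Function.onFun Disjoint f)) :
    HasSum (fun i => ∑' j : ℕ, c j * N j (f i)) (∑' j : ℕ, c j * N j (⋃ i, f i)) := by
  have hsum : ∀ j : ℕ, HasSum (fun i => c j * (VectorMeasure.variation (N j)).real (f i))
      (c j * (VectorMeasure.variation (N j)).real (⋃ i, f i)) := by
    intro j
    have h := (VectorMeasure.variation (N j)).toSignedMeasure.m_iUnion hf hd
    simp only [Measure.toSignedMeasure_apply_measurable (hf _),
      Measure.toSignedMeasure_apply_measurable (MeasurableSet.iUnion hf)] at h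
    exact h.mul_left _
  have hg : Summable fun p : ℕ × ℕ =>
      c p.1 * (VectorMeasure.variation (N p.1)).real (f p.2) := by
    have hnn : (0 : ℕ × ℕ → ℝ) ≤ fun p : ℕ × ℕ =>
        c p.1 * (VectorMeasure.variation (N p.1)).real (f p.2) :=
      fun p => mul_nonneg (hc0 _) measureReal_nonneg
    refine (summable_prod_of_nonneg hnn).2 ⟨fun j => (hsum j).summable, ?_⟩
    refine Summable.of_nonneg_of_le
      (fun j => tsum_nonneg fun i => mul_nonneg (hc0 _) measureReal_nonneg) (fun j => ?_) hb
    rw [(hsum j).tsum_eq]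
    exact mul_le_mul_of_nonneg_left (measureReal_mono (Set.subset_univ _)) (hc0 j)
  have hS : Summable (Function.uncurry fun j i : ℕ => c j * N j (f i)) := by
    refine Summable.of_norm_bounded hg fun p => ?_
    rw [Function.uncurry, norm_mul, Real.norm_of_nonneg (hc0 _)]
    exact mul_le_mul_of_nonneg_left VectorMeasure.norm_measure_le_variation (hc0 _)
  have hU : ∀ j : ℕ, ∑' i, c j * N j (f i) = c j * N j (⋃ i, f i) := fun j =>
    (((N j).m_iUnion hf hd).mul_left _).tsum_eq
  have h := hS.prod_symm.prod.hasSum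
  have h2 := hS.tsum_comm
  simp only [hU] at h2
  rw [← h2]
  exact h

/-- The exponential measure `exp {M} = ∑_{j ≥ 0} M^{*j} / j!` of a signed measure `M`. -/
noncomputable def signedExp {E : Type*} [AddMonoid E] [MeasurableSpace E] [MeasurableAdd₂ E]
    (M : SignedMeasure E) : SignedMeasure E where
  measureOf' A := ∑' j : ℕ, ((j.factorial : ℝ))⁻¹ * signedConvPow M j A
  empty' := by simp
  not_measurable' A hA := by simp [VectorMeasure.not_measurable _ hA]
  m_iUnion' f hf hd :=
    signedMeasure_series_hasSum_iUnion (fun j : ℕ => ((j.factorial : ℝ))⁻¹)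
      (fun j => by positivity) (signedConvPow M) (signedExp_summable_bound M) f hf hd

/-- The total variation distance `sup_B |M{B} - V{B}|`, the supremum being over measurable sets. -/
noncomputable def signedTVDist {E : Type*} [MeasurableSpace E] (M V : SignedMeasure E) : ℝ≥0∞ :=
  ⨆ (B : Set E) (_ : MeasurableSet B), ENNReal.ofReal |M B - V B|

/-- The measure `exp {l (F - I)}`, where `I` is the unit mass at the origin; for `l > 0` this is the
compound Poisson law with parameter `l` and compounding law `F`. -/
noncomputable def compoundPoisson {E : Type*} [AddMonoid E] [MeasurableSpace E] [MeasurableAdd₂ E]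
    (l : ℝ) (F : Measure E) [IsFiniteMeasure F] : SignedMeasure E :=
  signedExp (l • (F.toSignedMeasure - (Measure.dirac (0 : E)).toSignedMeasure))

/-- For a law `P` on the lattice line `{k y : k ∈ ℤ}`, the number `σ ∈ [0, ∞]` with
`σ ^ 2 = ∑_{k ∈ ℤ} k ^ 2 P{k y}`. -/
noncomputable def lineSigma {E : Type*} [AddGroup E] [MeasurableSpace E]
    (P : Measure E) (y : E) : ℝ≥0∞ :=
  (∑' k : ℤ, ENNReal.ofReal ((k : ℝ) ^ 2) * P {k • y}) ^ (1 / 2 : ℝ)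

/-! ### Algebra of signed convolution -/

section SignedConvolution

variable {E : Type*} [AddMonoid E] [MeasurableSpace E] [MeasurableAdd₂ E]

/-! The proof splits the law into one-dimensional factors and bounds each factor by Fourier analysis
on the integers.

Splitting. The law `exp {a(F - I)}` is the Poisson mixture of the convolution powers of `F`, with
characteristic function `exp (a(F̂ - 1))`. Since `F̂ - 1 = ∑ p_m (F̂_m - 1)`, it is the convolution
of the laws `exp {a p_m (F_m - I)}`. Total variation distance is subadditive under convolution of
probability laws, so it suffices to compare the factors with parameters `u = a p_m` and `v = b p_m`.
The ratio `|v - u| / max u v` does not depend on `p_m`. If some `σ_m` is infinite, the right-hand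
side is infinite unless `a = b`.

One factor. `F_m` is the image of a symmetric law `φ` on the non-zero integers with second moment `V
= σ²`, and `V ≥ 1` because `φ` has no mass at `0`. With `ψ(t) = ∫ (1 - cos kt) dφ`, the factor with
parameter `u` has characteristic function `exp (-uψ)`. The distance is at most half the `ℓ¹` norm of
the Fourier coefficients of `f = exp (-uψ) - exp (-vψ)`, where `u ≤ v`. Beurling's inequality
(`sum_le_sqrt_of_sum_sq_le`) bounds this norm by the square means of `f` and `f'`, with a free scale
`β`.

Square means. Three pointwise bounds are used: `|f| ≤ (v - u) ψ exp (-uψ)`, `ψ'² ≤ 2Vψ`, and `|v exp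
(-vψ) - u exp (-uψ)| ≤ (v - u) exp (-2uψ/3)`. They reduce the means to averages of `exp (-sψ)`,
which are at most `√(π / (8s))` by Jensen's inequality (`average_exp_neg_charExponent_le`).

Constants. For `v ≤ 0.6` crude pointwise bounds suffice. For larger `v`, either the claimed bound is
at least `1` and so trivial, or `u ≥ 0.58 v` and the averaged bounds apply with `β = 2σ√u`. -/

theorem signedConv_add_left (M N V : SignedMeasure E) :
    signedConv (M + N) V = signedConv M V + signedConv N V := by
  unfold signedConv
  rw [← VectorMeasure.map_add]
  congr 1
  refine VectorMeasure.prod_eq_of_forall_apply_prod fun s t _ _ => ?_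
  simp

theorem signedConv_smul_left (c : ℝ) (M V : SignedMeasure E) :
    signedConv (c • M) V = c • signedConv M V := by
  unfold signedConv
  rw [← VectorMeasure.map_smul]
  congr 1
  refine VectorMeasure.prod_eq_of_forall_apply_prod fun s t _ _ => ?_
  simp [mul_assoc]

theorem signedConv_sub_right (M V W : SignedMeasure E) :
    signedConv M (V - W) = signedConv M V - signedConv M W := by
  rw [eq_sub_iff_add_eq]
  unfold signedConv
  rw [← VectorMeasure.map_add]
  congr 1
  symm
  refine VectorMeasure.prod_eq_of_forall_apply_prod fun s t _ _ => ?_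
  simp [mul_sub]

theorem signedConv_smul_right (c : ℝ) (M V : SignedMeasure E) :
    signedConv M (c • V) = c • signedConv M V := by
  unfold signedConv
  rw [← VectorMeasure.map_smul]
  congr 1
  refine VectorMeasure.prod_eq_of_forall_apply_prod fun s t _ _ => ?_
  simp [mul_left_comm]

theorem signedConv_toSignedMeasure (μ ν : Measure E) [IsFiniteMeasure μ] [IsFiniteMeasure ν] :
    signedConv μ.toSignedMeasure ν.toSignedMeasure = (μ ∗ ν).toSignedMeasure := by
  have h : VectorMeasure.prod μ.toSignedMeasure ν.toSignedMeasure (ContinuousLinearMap.mul ℝ ℝ)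
      = (μ.prod ν).toSignedMeasure := by
    refine VectorMeasure.prod_eq_of_forall_apply_prod fun s t hs ht => ?_
    simp [hs, ht, hs.prod ht, measureReal_prod_prod]
  unfold signedConv
  rw [h]
  ext B hB
  rw [VectorMeasure.map_apply _ measurable_add hB,
    Measure.toSignedMeasure_apply_measurable (measurable_add hB),
    Measure.toSignedMeasure_apply_measurable hB, Measure.conv,
    map_measureReal_apply measurable_add hB]

end SignedConvolution

/-! ### Compound Poisson laws as Poisson mixtures of convolution powers -/

section ConvolutionPowers

variable {E : Type*} [AddMonoid E] [MeasurableSpace E]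

/-- The convolution powers of a positive measure. -/
noncomputable def convPow (F : Measure E) : ℕ → Measure E
  | 0 => Measure.dirac 0
  | j + 1 => convPow F j ∗ F

variable [MeasurableAdd₂ E]

instance convPow_isProbabilityMeasure (F : Measure E) [IsProbabilityMeasure F] (j : ℕ) :
    IsProbabilityMeasure (convPow F j) := by
  induction j with
  | zero => unfold convPow; infer_instance
  | succ j ih => unfold convPow; infer_instance

/-- The polynomial `∑ cᵢ Xⁱ` evaluated at a law `F` in the convolution algebra. -/
noncomputable def convAeval (F : Measure E) [IsProbabilityMeasure F] :
    Polynomial ℝ →ₗ[ℝ] SignedMeasure E :=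
  Polynomial.lsum fun i => LinearMap.toSpanSingleton ℝ _ (convPow F i).toSignedMeasure

theorem convAeval_monomial (F : Measure E) [IsProbabilityMeasure F] (i : ℕ) (c : ℝ) :
    convAeval F (Polynomial.monomial i c) = c • (convPow F i).toSignedMeasure := by
  simp [convAeval, Polynomial.lsum_apply]

/-- This intertwining relation moves the powers of `l(F - I)` into `ℝ[X]`, where the binomial
theorem is available. Associativity of signed convolution is never needed. -/
theorem convAeval_mul_X_sub_C (F : Measure E) [IsProbabilityMeasure F] (l : ℝ)
    (P : Polynomial ℝ) :
    signedConv (convAeval F P)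
      (l • (F.toSignedMeasure - (Measure.dirac (0 : E)).toSignedMeasure)) =
      convAeval F (P * (Polynomial.C l * Polynomial.X + Polynomial.C (-l))) := by
  induction P using Polynomial.induction_on' with
  | add p q hp hq => rw [map_add, signedConv_add_left, hp, hq, add_mul, map_add]
  | monomial i c =>
    rw [mul_add, ← mul_assoc, Polynomial.monomial_mul_C, Polynomial.monomial_mul_X,
      Polynomial.monomial_mul_C, map_add, convAeval_monomial, convAeval_monomial,
      convAeval_monomial, signedConv_smul_left, signedConv_smul_right, signedConv_sub_right,
      signedConv_toSignedMeasure, signedConv_toSignedMeasure]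
    have h : (convPow F i ∗ Measure.dirac (0 : E)).toSignedMeasure
        = (convPow F i).toSignedMeasure :=
      Measure.toSignedMeasure_congr (Measure.conv_dirac_zero _)
    have h' : (convPow F i ∗ F).toSignedMeasure = (convPow F (i + 1)).toSignedMeasure := rfl
    rw [h, h', smul_smul, smul_sub, sub_eq_add_neg, mul_neg]
    exact congrArg _ (neg_smul _ _).symm

theorem signedConvPow_eq_convAeval (F : Measure E) [IsProbabilityMeasure F] (l : ℝ) (j : ℕ) :
    signedConvPow (l • (F.toSignedMeasure - (Measure.dirac (0 : E)).toSignedMeasure)) j =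
      convAeval F ((Polynomial.C l * Polynomial.X + Polynomial.C (-l)) ^ j) := by
  induction j with
  | zero =>
    rw [pow_zero, ← Polynomial.monomial_zero_one, convAeval_monomial, one_smul]
    rfl
  | succ j ih =>
    rw [pow_succ, ← convAeval_mul_X_sub_C, ← ih]
    rfl

theorem inv_factorial_mul_signedConvPow_apply (F : Measure E) [IsProbabilityMeasure F] (l : ℝ)
    (j : ℕ) {B : Set E} (hB : MeasurableSet B) :
    ((j.factorial : ℝ))⁻¹ *
      signedConvPow (l • (F.toSignedMeasure - (Measure.dirac (0 : E)).toSignedMeasure)) j B =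
      ∑ k ∈ Finset.range (j + 1), (l ^ k / k.factorial * (convPow F k).real B) *
        ((-l) ^ (j - k) / (j - k).factorial) := by
  have h : (Polynomial.C l * Polynomial.X + Polynomial.C (-l)) ^ j =
      ∑ k ∈ Finset.range (j + 1),
        Polynomial.monomial k (l ^ k * (-l) ^ (j - k) * (j.choose k : ℝ)) := by
    rw [add_pow]
    refine Finset.sum_congr rfl fun k _ => ?_
    rw [← Polynomial.C_mul_X_pow_eq_monomial]
    simp only [map_mul, map_pow, mul_pow, map_natCast]
    ring
  rw [signedConvPow_eq_convAeval, h, map_sum, FunLike.coe_sum, Finset.sum_apply,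
    Finset.mul_sum]
  refine Finset.sum_congr rfl fun k hk => ?_
  have hkj : k ≤ j := by simpa [Nat.lt_succ_iff] using hk
  rw [convAeval_monomial, FunLike.coe_smul, Pi.smul_apply,
    Measure.toSignedMeasure_apply_measurable hB, smul_eq_mul, Nat.cast_choose ℝ hkj]
  have := Nat.factorial_ne_zero j
  field_simp

theorem compoundPoisson_apply (F : Measure E) [IsProbabilityMeasure F] (l : ℝ)
    {B : Set E} (hB : MeasurableSet B) :
    compoundPoisson l F B =
      Real.exp (-l) * ∑' k : ℕ, l ^ k / k.factorial * (convPow F k).real B := by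
  have h1 : Summable fun k : ℕ => ‖l ^ k / k.factorial * (convPow F k).real B‖ := by
    refine Summable.of_nonneg_of_le (fun _ => norm_nonneg _) (fun k => ?_)
      (Real.summable_pow_div_factorial ‖l‖)
    rw [norm_mul, norm_div, norm_pow, Real.norm_natCast,
      Real.norm_of_nonneg measureReal_nonneg]
    exact mul_le_of_le_one_right (by positivity) measureReal_le_one
  have h2 : Summable fun k : ℕ => ‖(-l) ^ k / (k.factorial : ℝ)‖ :=
    (Real.summable_pow_div_factorial (-l)).norm
  -- After binomial expansion the exponential series is a Cauchy product; the second factor sums to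
  -- `exp (-l)`.
  have h3 := tsum_mul_tsum_eq_tsum_sum_range_of_summable_norm h1 h2
  have h4 : compoundPoisson l F B = ∑' j : ℕ, ((j.factorial : ℝ))⁻¹ *
      signedConvPow (l • (F.toSignedMeasure - (Measure.dirac (0 : E)).toSignedMeasure)) j B := rfl
  rw [h4]
  simp_rw [inv_factorial_mul_signedConvPow_apply F l _ hB]
  rw [← h3, mul_comm, Real.exp_eq_exp_ℝ, NormedSpace.exp_eq_tsum_div]

/-- The compound Poisson law as a mixture of convolution powers. -/
noncomputable def poissonMixture (l : ℝ) (F : Measure E) : Measure E :=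
  Measure.sum fun k : ℕ => ENNReal.ofReal (Real.exp (-l) * (l ^ k / k.factorial)) • convPow F k

theorem tsum_ofReal_poisson_weights {l : ℝ} (hl : 0 ≤ l) :
    ∑' k : ℕ, ENNReal.ofReal (Real.exp (-l) * (l ^ k / k.factorial)) = 1 := by
  rw [← ENNReal.ofReal_tsum_of_nonneg (fun k => by positivity)
    ((Real.summable_pow_div_factorial l).mul_left _), tsum_mul_left]
  have : ∑' k : ℕ, l ^ k / (k.factorial : ℝ) = Real.exp l := by
    rw [Real.exp_eq_exp_ℝ, NormedSpace.exp_eq_tsum_div]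
  rw [this, ← Real.exp_add]
  simp

theorem isProbabilityMeasure_poissonMixture {l : ℝ} (hl : 0 ≤ l) (F : Measure E)
    [IsProbabilityMeasure F] : IsProbabilityMeasure (poissonMixture l F) := by
  constructor
  simp [poissonMixture, Measure.sum_apply _ MeasurableSet.univ, tsum_ofReal_poisson_weights hl]

theorem compoundPoisson_apply_eq_poissonMixture {l : ℝ} (hl : 0 ≤ l) (F : Measure E)
    [IsProbabilityMeasure F] {B : Set E} (hB : MeasurableSet B) :
    compoundPoisson l F B = (poissonMixture l F).real B := by
  rw [compoundPoisson_apply F l hB, measureReal_def, poissonMixture, Measure.sum_apply _ hB,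
    ENNReal.tsum_toReal_eq (fun k => by
      rw [Measure.smul_apply, smul_eq_mul]; finiteness), ← tsum_mul_left]
  refine tsum_congr fun k => ?_
  rw [Measure.smul_apply, smul_eq_mul, ENNReal.toReal_mul, ENNReal.toReal_ofReal (by positivity),
    measureReal_def, mul_assoc]

end ConvolutionPowers

/-! ### Characteristic functions of Poisson mixtures -/

section CharFun

variable {E : Type*} [NormedAddCommGroup E] [InnerProductSpace ℝ E] [MeasurableSpace E]
  [BorelSpace E] [SecondCountableTopology E]

theorem charFun_convPow (F : Measure E) [IsProbabilityMeasure F] (k : ℕ) (t : E) :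
    charFun (convPow F k) t = charFun F t ^ k := by
  induction k with
  | zero => simp [convPow, charFun_dirac]
  | succ k ih => rw [convPow, charFun_conv, ih, pow_succ]

theorem charFun_poissonMixture {l : ℝ} (hl : 0 ≤ l) (F : Measure E) [IsProbabilityMeasure F]
    (t : E) : charFun (poissonMixture l F) t = Complex.exp (l * (charFun F t - 1)) := by
  have := isProbabilityMeasure_poissonMixture hl F
  have hint : Integrable (fun x => Complex.exp (inner ℝ x t * Complex.I)) (poissonMixture l F) := by
    refine Integrable.of_bound (C := 1) (by fun_prop) (Filter.Eventually.of_forall fun x => ?_)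
    rw [Complex.norm_exp_ofReal_mul_I]
  rw [charFun_apply]
  unfold poissonMixture at hint ⊢
  rw [integral_sum_measure hint]
  simp_rw [integral_smul_measure, ← charFun_apply, charFun_convPow]
  have h (k : ℕ) : (ENNReal.ofReal (Real.exp (-l) * (l ^ k / k.factorial))).toReal •
      charFun F t ^ k = Complex.exp (-l) * ((l * charFun F t) ^ k / k.factorial) := by
    rw [ENNReal.toReal_ofReal (by positivity), Complex.real_smul]
    push_cast
    ring
  simp_rw [h]
  rw [tsum_mul_left]
  have h2 : ∑' k : ℕ, (l * charFun F t) ^ k / (k.factorial : ℂ) = Complex.exp (l * charFun F t) := by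
    rw [Complex.exp_eq_exp_ℂ, NormedSpace.exp_eq_tsum_div]
  rw [h2, ← Complex.exp_add]
  ring_nf

end CharFun

/-! ### Total variation distance under convolution -/

section ConvolutionDistance

variable {E : Type*} [AddCommMonoid E] [MeasurableSpace E] [MeasurableAdd₂ E]

/-- By Fubini, `(μ ∗ ν)(B)` is the `μ`-average of `ν` over the translated slices of `B`, and the
assumed bound holds on every slice. -/
theorem abs_conv_real_sub_conv_real_le {μ ν₁ ν₂ : Measure E} [IsProbabilityMeasure μ]
    [IsProbabilityMeasure ν₁] [IsProbabilityMeasure ν₂] {D : ℝ}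
    (h : ∀ B, MeasurableSet B → |ν₁.real B - ν₂.real B| ≤ D) {B : Set E} (hB : MeasurableSet B) :
    |(μ ∗ ν₁).real B - (μ ∗ ν₂).real B| ≤ D := by
  have hB' : MeasurableSet ((fun p : E × E => p.1 + p.2) ⁻¹' B) := measurable_add hB
  have key (ν : Measure E) [IsProbabilityMeasure ν] : (μ ∗ ν).real B =
      ∫ x, ν.real (Prod.mk x ⁻¹' ((fun p : E × E => p.1 + p.2) ⁻¹' B)) ∂μ := by
    rw [Measure.conv, map_measureReal_apply measurable_add hB, measureReal_def,
      Measure.prod_apply hB',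
      ← integral_toReal (measurable_measure_prodMk_left hB').aemeasurable
        (Filter.Eventually.of_forall fun x => measure_lt_top _ _)]
    rfl
  have hint (ν : Measure E) [IsProbabilityMeasure ν] : Integrable (fun x =>
      ν.real (Prod.mk x ⁻¹' ((fun p : E × E => p.1 + p.2) ⁻¹' B))) μ := by
    refine Integrable.of_bound (C := 1) ?_ (Filter.Eventually.of_forall fun x => ?_)
    · exact (measurable_measure_prodMk_left hB').ennreal_toReal.aestronglyMeasurable
    · rw [Real.norm_of_nonneg measureReal_nonneg]
      exact measureReal_le_one
  rw [key, key, ← integral_sub (hint ν₁) (hint ν₂), ← Real.norm_eq_abs]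
  refine (norm_integral_le_of_norm_le_const (C := D) (Filter.Eventually.of_forall fun x => ?_)).trans
    (by simp)
  exact h _ (measurable_prodMk_left hB')

/-- The factors are exchanged one at a time, through `μ₂ ∗ ν₁`; commutativity turns the first
exchange into one of the second factor. -/
theorem abs_conv_real_sub_conv_real_le_add {μ₁ μ₂ ν₁ ν₂ : Measure E} [IsProbabilityMeasure μ₁]
    [IsProbabilityMeasure μ₂] [IsProbabilityMeasure ν₁] [IsProbabilityMeasure ν₂] {C D : ℝ}
    (hμ : ∀ B, MeasurableSet B → |μ₁.real B - μ₂.real B| ≤ C)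
    (hν : ∀ B, MeasurableSet B → |ν₁.real B - ν₂.real B| ≤ D) {B : Set E} (hB : MeasurableSet B) :
    |(μ₁ ∗ ν₁).real B - (μ₂ ∗ ν₂).real B| ≤ C + D := by
  have h1 := abs_conv_real_sub_conv_real_le (μ := ν₁) hμ hB
  have h2 := abs_conv_real_sub_conv_real_le (μ := μ₂) hν hB
  rw [Measure.conv_comm ν₁, Measure.conv_comm ν₁] at h1
  exact (abs_sub_le _ _ _).trans (add_le_add h1 h2)

end ConvolutionDistance

/-! ### Splitting the compound Poisson law into factors -/

section Mixture

variable {E : Type*} [NormedAddCommGroup E] [InnerProductSpace ℝ E] [MeasurableSpace E]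
  [BorelSpace E] [SecondCountableTopology E]

/-- The distance between two products of compound Poisson laws is at most the sum of the distances
between the factors. -/
theorem exists_charFun_eq_exp_sum {ι : Type*} (s : Finset ι) (G : ι → Measure E)
    [∀ m, IsProbabilityMeasure (G m)] {r t : ι → ℝ} (hr : ∀ m, 0 ≤ r m) (ht : ∀ m, 0 ≤ t m)
    {D : ι → ℝ} (hD : ∀ m ∈ s, ∀ B, MeasurableSet B →
      |(poissonMixture (r m) (G m)).real B - (poissonMixture (t m) (G m)).real B| ≤ D m) :
    ∃ μ ν : Measure E, IsProbabilityMeasure μ ∧ IsProbabilityMeasure ν ∧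
      (∀ z, charFun μ z = Complex.exp (∑ m ∈ s, r m * (charFun (G m) z - 1))) ∧
      (∀ z, charFun ν z = Complex.exp (∑ m ∈ s, t m * (charFun (G m) z - 1))) ∧
      ∀ B, MeasurableSet B → |μ.real B - ν.real B| ≤ ∑ m ∈ s, D m := by
  classical
  induction s using Finset.induction_on with
  | empty =>
    refine ⟨Measure.dirac 0, Measure.dirac 0, inferInstance, inferInstance, ?_, ?_, ?_⟩ <;>
      simp [charFun_dirac]
  | insert i s hi ih =>
    obtain ⟨μ, ν, hμ, hν, hμc, hνc, hd⟩ := ih fun m hm => hD m (Finset.mem_insert_of_mem hm)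
    have := isProbabilityMeasure_poissonMixture (hr i) (G i)
    have := isProbabilityMeasure_poissonMixture (ht i) (G i)
    refine ⟨poissonMixture (r i) (G i) ∗ μ, poissonMixture (t i) (G i) ∗ ν, inferInstance,
      inferInstance, fun z => ?_, fun z => ?_, fun B hB => ?_⟩
    · rw [charFun_conv, charFun_poissonMixture (hr i), hμc, Finset.sum_insert hi, Complex.exp_add]
    · rw [charFun_conv, charFun_poissonMixture (ht i), hνc, Finset.sum_insert hi, Complex.exp_add]
    · rw [Finset.sum_insert hi]
      exact abs_conv_real_sub_conv_real_le_add (hD i (Finset.mem_insert_self _ _)) hd hB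

theorem charFun_mixture_sub_one {ι : Type*} [Fintype ι] {F : Measure E} {q : ℝ} (hq : 0 ≤ q)
    {p : ι → ℝ} (hp : ∀ m, 0 ≤ p m) (hsum : ∑ m, p m = 1 - q) (G : ι → Measure E)
    [∀ m, IsProbabilityMeasure (G m)]
    (hF : F = ENNReal.ofReal q • Measure.dirac 0 + ∑ m, ENNReal.ofReal (p m) • G m) (z : E) :
    charFun F z - 1 = ∑ m, p m * (charFun (G m) z - 1) := by
  have hint (μ : Measure E) [IsFiniteMeasure μ] :
      Integrable (fun x => Complex.exp (inner ℝ x z * Complex.I)) μ := by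
    refine Integrable.of_bound (C := 1) (by fun_prop) (Filter.Eventually.of_forall fun x => ?_)
    rw [Complex.norm_exp_ofReal_mul_I]
  have h : charFun F z = q + ∑ m, p m * charFun (G m) z := by
    rw [hF, charFun_apply, integral_add_measure, integral_finsetSum_measure]
    · simp [integral_smul_measure, ENNReal.toReal_ofReal, hq, hp, charFun_apply]
    · exact fun m _ => (hint _).smul_measure ENNReal.ofReal_ne_top
    · exact (hint _).smul_measure ENNReal.ofReal_ne_top
    · exact integrable_finsetSum_measure.2
        fun m _ => (hint _).smul_measure ENNReal.ofReal_ne_top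
  have h2 : (∑ m, (p m : ℂ)) = 1 - q := by exact_mod_cast congrArg (fun x : ℝ => (x : ℂ)) hsum
  rw [h]
  simp only [mul_sub, Finset.sum_sub_distrib, mul_one, h2]
  ring

/-- A law is determined by its characteristic function, so each of the two mixtures equals the
product of its one-line factors. The atom `qI` contributes nothing to `F̂ - 1`. -/
theorem abs_poissonMixture_sub_le_sum [CompleteSpace E] {ι : Type*} [Fintype ι] {F : Measure E}
    [IsProbabilityMeasure F] {q : ℝ} (hq : 0 ≤ q)
    {p : ι → ℝ} (hp : ∀ m, 0 ≤ p m) (hsum : ∑ m, p m = 1 - q) (G : ι → Measure E)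
    [∀ m, IsProbabilityMeasure (G m)]
    (hF : F = ENNReal.ofReal q • Measure.dirac 0 + ∑ m, ENNReal.ofReal (p m) • G m)
    {a b : ℝ} (ha : 0 ≤ a) (hb : 0 ≤ b) {D : ι → ℝ} (hD : ∀ m B, MeasurableSet B →
      |(poissonMixture (a * p m) (G m)).real B - (poissonMixture (b * p m) (G m)).real B| ≤ D m)
    {B : Set E} (hB : MeasurableSet B) :
    |(poissonMixture a F).real B - (poissonMixture b F).real B| ≤ ∑ m, D m := by
  obtain ⟨μ, ν, hμ, hν, hμc, hνc, hd⟩ := exists_charFun_eq_exp_sum Finset.univ G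
    (fun m => mul_nonneg ha (hp m)) (fun m => mul_nonneg hb (hp m)) fun m _ => hD m
  have := isProbabilityMeasure_poissonMixture ha F
  have := isProbabilityMeasure_poissonMixture hb F
  have h1 : poissonMixture a F = μ := by
    refine Measure.ext_of_charFun (funext fun z => ?_)
    rw [charFun_poissonMixture ha, hμc, charFun_mixture_sub_one hq hp hsum G hF, Finset.mul_sum]
    simp [mul_assoc]
  have h2 : poissonMixture b F = ν := by
    refine Measure.ext_of_charFun (funext fun z => ?_)
    rw [charFun_poissonMixture hb, hνc, charFun_mixture_sub_one hq hp hsum G hF, Finset.mul_sum]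
    simp [mul_assoc]
  rw [h1, h2]
  exact hd B hB

end Mixture

/-! ### Beurling's inequality for Fourier coefficients -/

section BeurlingInequality

theorem inv_one_add_sq_mul_sub_le_arctan_sub {x y : ℝ} (hy : 0 ≤ y) (hxy : y ≤ x) :
    (1 + x ^ 2)⁻¹ * (x - y) ≤ Real.arctan x - Real.arctan y := by
  refine Convex.mul_sub_le_image_sub_of_le_deriv (convex_Icc y x)
    Real.continuous_arctan.continuousOn Real.differentiable_arctan.differentiableOn ?_ y
    (Set.left_mem_Icc.2 hxy) x (Set.right_mem_Icc.2 hxy) hxy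
  intro z hz
  rw [interior_Icc] at hz
  simp only [Real.deriv_arctan, one_div]
  have h1 : z ^ 2 ≤ x ^ 2 := pow_le_pow_left₀ (hy.trans hz.1.le) hz.2.le 2
  exact inv_anti₀ (by positivity) (by linarith)

/-- Integral comparison: the summand decreases and `β * arctan (x / β)` is a primitive of it, so the
increments of the primitive telescope. -/
theorem sum_range_inv_one_add_div_sq_le {β : ℝ} (hβ : 0 < β) (n : ℕ) :
    ∑ i ∈ Finset.range n, (1 + (((i : ℝ) + 1) / β) ^ 2)⁻¹ ≤ β * (Real.pi / 2) := by
  have h : ∑ i ∈ Finset.range n, (1 + (((i : ℝ) + 1) / β) ^ 2)⁻¹ ≤ β * Real.arctan (n / β) := by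
    induction n with
    | zero => simp
    | succ n ih =>
      rw [Finset.sum_range_succ]
      have h1 := inv_one_add_sq_mul_sub_le_arctan_sub (x := ((n : ℝ) + 1) / β) (y := n / β)
        (by positivity) (by gcongr; linarith)
      have h2 : ((n : ℝ) + 1) / β - n / β = 1 / β := by ring
      rw [h2, mul_one_div, div_le_iff₀ hβ] at h1
      push_cast
      linarith
  exact h.trans (mul_le_mul_of_nonneg_left (Real.arctan_lt_pi_div_two _).le hβ.le)

theorem summable_and_tsum_inv_one_add_div_sq_le {β : ℝ} (hβ : 0 < β) :
    (Summable fun k : ℤ => (1 + ((k : ℝ) / β) ^ 2)⁻¹) ∧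
      ∑' k : ℤ, (1 + ((k : ℝ) / β) ^ 2)⁻¹ ≤ 1 + Real.pi * β := by
  have hs : Summable fun n : ℕ => (1 + (((n : ℝ) + 1) / β) ^ 2)⁻¹ :=
    summable_of_sum_range_le (fun n => by positivity) (sum_range_inv_one_add_div_sq_le hβ)
  have ht := hs.tsum_le_of_sum_range_le (sum_range_inv_one_add_div_sq_le hβ)
  have h1 : HasSum (fun n : ℕ => (1 + ((((n : ℤ) + 1 : ℤ) : ℝ) / β) ^ 2)⁻¹)
      (∑' n : ℕ, (1 + (((n : ℝ) + 1) / β) ^ 2)⁻¹) := by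
    simpa using hs.hasSum
  have h2 : HasSum (fun n : ℕ => (1 + (((-((n : ℤ) + 1) : ℤ) : ℝ) / β) ^ 2)⁻¹)
      (∑' n : ℕ, (1 + (((n : ℝ) + 1) / β) ^ 2)⁻¹) := by
    convert hs.hasSum using 3 with n
    push_cast
    ring
  have h3 := HasSum.of_add_one_of_neg_add_one (f := fun k : ℤ => (1 + ((k : ℝ) / β) ^ 2)⁻¹) h1 h2
  refine ⟨h3.summable, ?_⟩
  rw [h3.tsum_eq]
  simp only [Int.cast_zero, zero_div]
  norm_num
  linarith

/-- Beurling's inequality in sequence form. -/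
theorem sum_le_sqrt_of_sum_sq_le {β A B : ℝ} (hβ : 0 < β) {c : ℤ → ℝ} (s : Finset ℤ)
    (hA : ∑ k ∈ s, c k ^ 2 ≤ A) (hB : ∑ k ∈ s, (k : ℝ) ^ 2 * c k ^ 2 ≤ B) :
    ∑ k ∈ s, c k ≤ √((1 + Real.pi * β) * (A + B / β ^ 2)) := by
  refine Real.le_sqrt_of_sq_le ?_
  -- Cauchy–Schwarz with the weight `1 + (k / β)²`; its reciprocals sum to at most `1 + πβ`.
  have h1 := Finset.sum_sq_le_sum_mul_sum_of_sq_le_mul s (r := c)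
    (f := fun k : ℤ => (1 + ((k : ℝ) / β) ^ 2)⁻¹)
    (g := fun k : ℤ => (1 + ((k : ℝ) / β) ^ 2) * c k ^ 2)
    (fun k _ => by positivity) (fun k _ => by positivity)
    (fun k _ => by rw [inv_mul_cancel_left₀ (by positivity)])
  obtain ⟨h2, h3⟩ := summable_and_tsum_inv_one_add_div_sq_le hβ
  have h4 := (h2.sum_le_tsum s (fun k _ => by positivity)).trans h3
  refine h1.trans (mul_le_mul h4 ?_ (Finset.sum_nonneg fun k _ => by positivity) (by positivity))
  have h5 : ∑ k ∈ s, (1 + ((k : ℝ) / β) ^ 2) * c k ^ 2 =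
      ∑ k ∈ s, c k ^ 2 + (∑ k ∈ s, (k : ℝ) ^ 2 * c k ^ 2) / β ^ 2 := by
    rw [Finset.sum_div, ← Finset.sum_add_distrib]
    refine Finset.sum_congr rfl fun k _ => ?_
    ring
  rw [h5]
  gcongr

theorem memLp_two_restrict_Ioc {f : ℝ → ℂ} (hf : Continuous f) (a b : ℝ) :
    MemLp f 2 (volume.restrict (Set.Ioc a b)) := by
  obtain ⟨C, hC⟩ := (isCompact_Icc (a := a) (b := b)).exists_bound_of_continuousOn hf.continuousOn
  refine MemLp.of_bound hf.aestronglyMeasurable C ?_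
  filter_upwards [ae_restrict_mem measurableSet_Ioc] with x hx
  exact hC x (Set.Ioc_subset_Icc_self hx)

/-- Integration by parts; the boundary term vanishes because the endpoint values agree. -/
theorem norm_fourierCoeffOn_deriv {a b : ℝ} (hab : a < b) {f f' : ℝ → ℂ}
    (hf : ∀ x, HasDerivAt f (f' x) x) (hf' : Continuous f') (hper : f b = f a) {n : ℤ}
    (hn : n ≠ 0) : 2 * Real.pi * |(n : ℝ)| * ‖fourierCoeffOn hab f n‖ =
      (b - a) * ‖fourierCoeffOn hab f' n‖ := by
  rw [fourierCoeffOn_of_hasDerivAt hab hn (fun x _ => hf x) (hf'.intervalIntegrable _ _), hper,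
    sub_self, mul_zero, zero_sub, norm_mul, norm_neg, norm_mul, norm_div]
  have h1 : ‖(-2 * Real.pi * Complex.I * n : ℂ)‖ = 2 * Real.pi * |(n : ℝ)| := by
    simp [abs_of_pos Real.pi_pos]
  have h2 : ‖(b - a : ℂ)‖ = b - a := by
    rw [← Complex.ofReal_sub, Complex.norm_real, Real.norm_of_nonneg (sub_pos.2 hab).le]
  have h3 : 2 * Real.pi * |(n : ℝ)| ≠ 0 := by
    have : |(n : ℝ)| ≠ 0 := by simpa using hn
    positivity
  rw [h1, h2, norm_one]
  field_simp

theorem sum_norm_fourierCoeffOn_le {β : ℝ} (hβ : 0 < β) {f f' : ℝ → ℂ}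
    (hf : ∀ x, HasDerivAt f (f' x) x) (hf' : Continuous f')
    (hper : f Real.pi = f (-Real.pi)) (hab : -Real.pi < Real.pi) (s : Finset ℤ) :
    ∑ k ∈ s, ‖fourierCoeffOn hab f k‖ ≤
      √((1 + Real.pi * β) * ((2 * Real.pi)⁻¹ * (∫ x in -Real.pi..Real.pi, ‖f x‖ ^ 2) +
        ((2 * Real.pi)⁻¹ * ∫ x in -Real.pi..Real.pi, ‖f' x‖ ^ 2) / β ^ 2)) := by
  have hc : Continuous f := continuous_iff_continuousAt.2 fun x => (hf x).continuousAt
  have h2 : Real.pi - -Real.pi = 2 * Real.pi := by ring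
  have hA := hasSum_sq_fourierCoeffOn hab (memLp_two_restrict_Ioc hc _ _)
  have hB := hasSum_sq_fourierCoeffOn hab (memLp_two_restrict_Ioc hf' _ _)
  rw [h2, smul_eq_mul] at hA hB
  refine sum_le_sqrt_of_sum_sq_le hβ s (sum_le_hasSum s (fun _ _ => by positivity) hA)
    ((Finset.sum_le_sum fun k _ => ?_).trans (sum_le_hasSum s (fun _ _ => by positivity) hB))
  -- The derivative relation excludes `k = 0`, but there the weight `k²` is zero.
  rcases eq_or_ne k 0 with rfl | hk
  · simp
  · have h3 := norm_fourierCoeffOn_deriv hab hf hf' hper hk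
    rw [h2, mul_assoc, mul_right_inj' (by positivity)] at h3
    rw [← h3, mul_pow, sq_abs]

end BeurlingInequality

/-! ### The characteristic exponent of an integer law -/

section CharacteristicExponent

/-- The function `t ↦ 1 - Re φ̂(t)` for a law `φ` on the integers. -/
noncomputable def charExponent (φ : Measure ℤ) (t : ℝ) : ℝ := ∫ k : ℤ, (1 - Real.cos (k * t)) ∂φ

/-- The formal derivative of `charExponent φ`. -/
noncomputable def charExponentDeriv (φ : Measure ℤ) (t : ℝ) : ℝ :=
  ∫ k : ℤ, (k : ℝ) * Real.sin (k * t) ∂φ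

theorem integrable_of_abs_le_const {φ : Measure ℤ} [IsFiniteMeasure φ] {f : ℤ → ℝ} (C : ℝ)
    (h : ∀ k, |f k| ≤ C) : Integrable f φ :=
  Integrable.of_bound (measurable_of_countable f).aestronglyMeasurable C
    (Filter.Eventually.of_forall h)

theorem abs_one_sub_cos_le (x : ℝ) : |1 - Real.cos x| ≤ 2 := by
  rw [abs_le]
  constructor <;> linarith [Real.cos_le_one x, Real.neg_one_le_cos x]

variable {φ : Measure ℤ}

theorem charExponent_nonneg (t : ℝ) : 0 ≤ charExponent φ t :=
  integral_nonneg fun _ => sub_nonneg.2 (Real.cos_le_one _)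

theorem charExponent_le_two [IsProbabilityMeasure φ] (t : ℝ) : charExponent φ t ≤ 2 := by
  have h := integral_mono (μ := φ) (integrable_of_abs_le_const 2 fun k => abs_one_sub_cos_le (k * t))
    (integrable_const (2 : ℝ)) fun k => (le_abs_self _).trans (abs_one_sub_cos_le _)
  simpa [charExponent] using h

/-- On the integers `|k| ≤ k²`. The function `|k|` then dominates when differentiating under the
integral. -/
theorem integrable_intCast_of_sq (h2 : Integrable (fun k : ℤ => (k : ℝ) ^ 2) φ) :
    Integrable (fun k : ℤ => |(k : ℝ)|) φ := by
  refine Integrable.mono' h2 (measurable_of_countable _).aestronglyMeasurable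
    (Filter.Eventually.of_forall fun k => ?_)
  rw [Real.norm_of_nonneg (abs_nonneg _), ← sq_abs]
  have h : |k| ≤ |k| ^ 2 := by
    rcases eq_or_ne k 0 with rfl | hk
    · simp
    · have := Int.one_le_abs hk
      nlinarith
  exact_mod_cast h

theorem hasDerivAt_charExponent [IsProbabilityMeasure φ] (h2 : Integrable (fun k : ℤ => (k : ℝ) ^ 2) φ) (t : ℝ) :
    HasDerivAt (charExponent φ) (charExponentDeriv φ t) t := by
  refine (hasDerivAt_integral_of_dominated_loc_of_deriv_le (s := Set.univ)
    (F := fun t (k : ℤ) => 1 - Real.cos (k * t)) (x₀ := t)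
    (F' := fun t (k : ℤ) => k * Real.sin (k * t)) (bound := fun k : ℤ => |(k : ℝ)|)
    Filter.univ_mem (Filter.Eventually.of_forall fun _ =>
      (measurable_of_countable _).aestronglyMeasurable)
    (integrable_of_abs_le_const 2 fun k => abs_one_sub_cos_le _)
    (measurable_of_countable _).aestronglyMeasurable
    (Filter.Eventually.of_forall fun k x _ => ?_) (integrable_intCast_of_sq h2)
    (Filter.Eventually.of_forall fun k x _ => ?_)).2
  · rw [Real.norm_eq_abs, abs_mul]
    exact mul_le_of_le_one_right (abs_nonneg _) (Real.abs_sin_le_one _)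
  · have := ((Real.hasDerivAt_cos ((k : ℝ) * x)).comp x ((hasDerivAt_id x).const_mul (k : ℝ))).const_sub 1
    convert this using 1
    simp
    ring

theorem continuous_charExponentDeriv (h2 : Integrable (fun k : ℤ => (k : ℝ) ^ 2) φ) :
    Continuous (charExponentDeriv φ) := by
  refine continuous_of_dominated (bound := fun k : ℤ => |(k : ℝ)|)
    (fun _ => (measurable_of_countable _).aestronglyMeasurable)
    (fun x => Filter.Eventually.of_forall fun k => ?_) (integrable_intCast_of_sq h2)
    (Filter.Eventually.of_forall fun k => by fun_prop)
  rw [Real.norm_eq_abs, abs_mul]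
  exact mul_le_of_le_one_right (abs_nonneg _) (Real.abs_sin_le_one _)

theorem continuous_charExponent [IsProbabilityMeasure φ] : Continuous (charExponent φ) := by
  refine continuous_of_dominated (bound := fun _ => 2)
    (fun _ => (measurable_of_countable _).aestronglyMeasurable)
    (fun x => Filter.Eventually.of_forall fun k => ?_) (integrable_const _)
    (Filter.Eventually.of_forall fun k => by fun_prop)
  exact abs_one_sub_cos_le _

theorem charExponent_neg (t : ℝ) : charExponent φ (-t) = charExponent φ t := by
  simp [charExponent]

/-- Cauchy–Schwarz for `∫ k sin (kt) dφ`, followed by `sin² ≤ 2(1 - cos)`. This makes `ψ'` small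
wherever `ψ` is small. -/
theorem charExponentDeriv_sq_le [IsProbabilityMeasure φ] (h2 : Integrable (fun k : ℤ => (k : ℝ) ^ 2) φ)
    (hV : 0 < ∫ k : ℤ, (k : ℝ) ^ 2 ∂φ) (t : ℝ) :
    charExponentDeriv φ t ^ 2 ≤ 2 * (∫ k : ℤ, (k : ℝ) ^ 2 ∂φ) * charExponent φ t := by
  set V := ∫ k : ℤ, (k : ℝ) ^ 2 ∂φ with hVdef
  set S := charExponentDeriv φ t with hS
  have hsin : Integrable (fun k : ℤ => Real.sin (k * t) ^ 2) φ :=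
    integrable_of_abs_le_const 1 fun k => by
      rw [abs_of_nonneg (sq_nonneg _)]; exact Real.sin_sq_le_one _
  have hks : Integrable (fun k : ℤ => (k : ℝ) * Real.sin (k * t)) φ :=
    Integrable.mono' (integrable_intCast_of_sq h2) (measurable_of_countable _).aestronglyMeasurable
      (Filter.Eventually.of_forall fun k => by
        rw [Real.norm_eq_abs, abs_mul]
        exact mul_le_of_le_one_right (abs_nonneg _) (Real.abs_sin_le_one _))
  -- Cauchy–Schwarz in quadratic form: expanding this square and dividing by `V` gives `S² ≤ V ∫
  -- sin²`.
  have h0 : 0 ≤ ∫ k : ℤ, (V * Real.sin (k * t) - S * k) ^ 2 ∂φ :=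
    integral_nonneg fun _ => sq_nonneg _
  have h1 : ∫ k : ℤ, (V * Real.sin (k * t) - S * k) ^ 2 ∂φ =
      V ^ 2 * ∫ k : ℤ, Real.sin (k * t) ^ 2 ∂φ - V * S ^ 2 := by
    have : ∀ k : ℤ, (V * Real.sin (k * t) - S * k) ^ 2 = V ^ 2 * Real.sin (k * t) ^ 2 -
        2 * V * S * (k * Real.sin (k * t)) + S ^ 2 * (k : ℝ) ^ 2 := fun k => by ring
    simp_rw [this]
    rw [integral_add (f := fun k : ℤ => V ^ 2 * Real.sin (k * t) ^ 2 -
        2 * V * S * (k * Real.sin (k * t))) ((hsin.const_mul _).sub (hks.const_mul _))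
        (h2.const_mul _), integral_sub (hsin.const_mul _) (hks.const_mul _), integral_const_mul, integral_const_mul,
      integral_const_mul]
    change _ - 2 * V * S * S + S ^ 2 * V = _
    ring
  have h3 : ∫ k : ℤ, Real.sin (k * t) ^ 2 ∂φ ≤ 2 * charExponent φ t := by
    rw [charExponent, ← integral_const_mul]
    refine integral_mono hsin
      ((integrable_of_abs_le_const 2 fun k => abs_one_sub_cos_le _).const_mul 2) fun k => ?_
    have := Real.sin_sq_add_cos_sq (k * t)
    dsimp only
    nlinarith [sq_nonneg (1 - Real.cos (k * t))]
  rw [h1] at h0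
  have h4 : S ^ 2 ≤ V * ∫ k : ℤ, Real.sin (k * t) ^ 2 ∂φ :=
    le_of_mul_le_mul_left (by linarith) hV
  nlinarith

end CharacteristicExponent

/-! ### Averages of `exp (-sψ)` over a period -/

section AverageBound

/-- On `[-π, π]` one has `1 - cos t ≥ 2t² / π²`, which leaves a Gaussian integral. -/
theorem integral_exp_neg_mul_one_sub_cos_le {s : ℝ} (hs : 0 < s) :
    ∫ t in -Real.pi..Real.pi, Real.exp (-(s * (1 - Real.cos t))) ≤
      √(Real.pi ^ 3 / (2 * s)) := by
  have hpi := Real.pi_pos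
  set b := 2 * s / Real.pi ^ 2 with hb
  have hb0 : 0 < b := by positivity
  have hle : -Real.pi ≤ Real.pi := by linarith
  calc ∫ t in -Real.pi..Real.pi, Real.exp (-(s * (1 - Real.cos t)))
      ≤ ∫ t in -Real.pi..Real.pi, Real.exp (-b * t ^ 2) := by
        refine intervalIntegral.integral_mono_on hle
          (Continuous.intervalIntegrable (by fun_prop) _ _)
          (Continuous.intervalIntegrable (by fun_prop) _ _) fun t ht => ?_
        have h := Real.cos_le_one_sub_mul_cos_sq (abs_le.2 ht)
        refine Real.exp_le_exp.2 ?_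
        have h2 : s * (2 / Real.pi ^ 2 * t ^ 2) ≤ s * (1 - Real.cos t) := by gcongr; linarith
        have h3 : b * t ^ 2 = s * (2 / Real.pi ^ 2 * t ^ 2) := by rw [hb]; ring
        linarith
    _ ≤ ∫ t, Real.exp (-b * t ^ 2) := by
        rw [intervalIntegral.integral_of_le hle]
        exact setIntegral_le_integral (integrable_exp_neg_mul_sq hb0)
          (Filter.Eventually.of_forall fun t => (Real.exp_pos _).le)
    _ = √(Real.pi ^ 3 / (2 * s)) := by
        rw [integral_gaussian, hb]
        congr 1
        field_simp

/-- The substitution `t ↦ kt` covers `k` periods (with sign), and the Jacobian `1 / k` compensates.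
-/
theorem integral_comp_intCast_mul {h : ℝ → ℝ} (hc : Continuous h)
    (hp : Function.Periodic h (2 * Real.pi)) {k : ℤ} (hk : k ≠ 0) :
    ∫ t in -Real.pi..Real.pi, h (k * t) = ∫ t in -Real.pi..Real.pi, h t := by
  have hk' : (k : ℝ) ≠ 0 := by exact_mod_cast hk
  have h1 := hp.intervalIntegral_add_zsmul_eq k (k * -Real.pi)
    fun _ _ => hc.intervalIntegrable _ _
  have h2 := hp.intervalIntegral_add_eq (k * -Real.pi) (-Real.pi)
  have h3 : (k : ℝ) * -Real.pi + k • (2 * Real.pi) = k * Real.pi := by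
    rw [zsmul_eq_mul]; ring
  have h4 : -Real.pi + 2 * Real.pi = Real.pi := by ring
  rw [intervalIntegral.integral_comp_mul_left _ hk', ← h3, h1, h2, h4, zsmul_eq_mul, smul_eq_mul,
    inv_mul_cancel_left₀ hk']

variable {φ : Measure ℤ} [IsProbabilityMeasure φ]

/-- A concentration bound for the compound Poisson law: the average of `exp (-s (1 - φ̂))` over a
period is maximal when `φ` is carried by `{-1, 1}`. -/
theorem average_exp_neg_charExponent_le (h0 : φ {0} = 0) {s : ℝ} (hs : 0 < s) :
    (2 * Real.pi)⁻¹ * ∫ t in -Real.pi..Real.pi, Real.exp (-(s * charExponent φ t)) ≤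
      √(Real.pi / (8 * s)) := by
  have hpi := Real.pi_pos
  have hbd : ∀ x : ℝ, ‖Real.exp (-(s * (1 - Real.cos x)))‖ ≤ 1 := fun x => by
    rw [Real.norm_of_nonneg (Real.exp_pos _).le, Real.exp_le_one_iff, neg_nonpos]
    exact mul_nonneg hs.le (sub_nonneg.2 (Real.cos_le_one _))
  have hint : ∀ t : ℝ, Integrable (fun k : ℤ => Real.exp (-(s * (1 - Real.cos (k * t))))) φ :=
    fun t => integrable_of_abs_le_const 1 fun k => hbd _
  -- Jensen's inequality moves the `φ`-average outside the exponential. After Fubini every `k ≠ 0`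
  -- contributes the same as `k = 1`, and `φ {0} = 0` excludes the bad frequency.
  have hjensen : ∀ t : ℝ, Real.exp (-(s * charExponent φ t)) ≤
      ∫ k : ℤ, Real.exp (-(s * (1 - Real.cos (k * t)))) ∂φ := fun t => by
    have h := convexOn_exp.map_integral_le (μ := φ) (f := fun k : ℤ => -(s * (1 - Real.cos (k * t))))
      Real.continuous_exp.continuousOn isClosed_univ (by simp)
      ((integrable_of_abs_le_const 2 fun k => abs_one_sub_cos_le _).const_mul s).neg (hint t)
    rwa [integral_neg, integral_const_mul] at h
  have : IsFiniteMeasure (volume.restrict (Set.uIoc (-Real.pi) Real.pi)) := by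
    rw [Set.uIoc]; infer_instance
  have hswap := intervalIntegral_integral_swap (μ := φ) (a := -Real.pi) (b := Real.pi)
    (f := fun t (k : ℤ) => Real.exp (-(s * (1 - Real.cos (k * t))))) (by
      refine Integrable.of_bound (C := 1) ?_ (Filter.Eventually.of_forall fun p => hbd _)
      refine Measurable.aestronglyMeasurable ?_
      have : Measurable fun k : ℤ => (k : ℝ) := measurable_of_countable _
      unfold Function.uncurry
      fun_prop)
  have hcont : Continuous fun t : ℝ => ∫ k : ℤ, Real.exp (-(s * (1 - Real.cos (k * t)))) ∂φ :=
    continuous_of_dominated (bound := fun _ => 1)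
      (fun _ => (measurable_of_countable _).aestronglyMeasurable)
      (fun x => Filter.Eventually.of_forall fun k => hbd _) (integrable_const _)
      (Filter.Eventually.of_forall fun k => by fun_prop)
  have hinner : ∫ k : ℤ, (∫ t in -Real.pi..Real.pi, Real.exp (-(s * (1 - Real.cos (k * t))))) ∂φ =
      ∫ t in -Real.pi..Real.pi, Real.exp (-(s * (1 - Real.cos t))) := by
    have hne : ∀ᵐ k ∂φ, k ≠ 0 := by
      rw [ae_iff]
      simpa using h0
    rw [integral_congr_ae (hne.mono fun k hk => integral_comp_intCast_mul
      (h := fun t => Real.exp (-(s * (1 - Real.cos t)))) (by fun_prop)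
      (fun t => by simp [Real.cos_add_two_pi]) hk)]
    simp
  have hmain : ∫ t in -Real.pi..Real.pi, Real.exp (-(s * charExponent φ t)) ≤
      √(Real.pi ^ 3 / (2 * s)) := by
    refine le_trans (intervalIntegral.integral_mono_on (by linarith)
      (Continuous.intervalIntegrable ?_ _ _) (hcont.intervalIntegrable _ _)
      fun t _ => hjensen t) ?_
    · have := continuous_charExponent (φ := φ)
      fun_prop
    · rw [hswap, hinner]
      exact integral_exp_neg_mul_one_sub_cos_le hs
  calc _ ≤ (2 * Real.pi)⁻¹ * √(Real.pi ^ 3 / (2 * s)) := by gcongr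
    _ = √(Real.pi / (8 * s)) := by
        rw [← Real.sqrt_sq (show 0 ≤ (2 * Real.pi)⁻¹ by positivity), ← Real.sqrt_mul (by positivity)]
        congr 1
        field_simp
        norm_num

end AverageBound

/-! ### Elementary exponential inequalities -/

section ExponentialInequalities

theorem mul_exp_neg_mul_le {κ : ℝ} (hκ : 0 < κ) (x : ℝ) :
    x * Real.exp (-(κ * x)) ≤ 0.36788 / κ := by
  have h1 : κ * x * Real.exp (-(κ * x)) ≤ Real.exp (-1) := by
    have h := Real.add_one_le_exp (κ * x - 1)
    have h2 : Real.exp (κ * x - 1) * Real.exp (-(κ * x)) = Real.exp (-1) := by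
      rw [← Real.exp_add]; ring_nf
    rw [← h2]
    gcongr
    linarith
  have h3 := Real.exp_neg_one_lt_d9
  rw [le_div_iff₀ hκ]
  linarith

theorem abs_exp_sub_exp_le {u v x : ℝ} (huv : u ≤ v) (hx : 0 ≤ x) :
    |Real.exp (-(u * x)) - Real.exp (-(v * x))| ≤ (v - u) * x * Real.exp (-(u * x)) := by
  have h1 : Real.exp (-(v * x)) = Real.exp (-(u * x)) * Real.exp (-((v - u) * x)) := by
    rw [← Real.exp_add]; ring_nf
  have h2 := Real.one_sub_le_exp_neg ((v - u) * x)
  have h3 : Real.exp (-(v * x)) ≤ Real.exp (-(u * x)) :=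
    Real.exp_le_exp.2 (neg_le_neg (mul_le_mul_of_nonneg_right huv hx))
  rw [abs_of_nonneg (sub_nonneg.2 h3), h1]
  nlinarith [Real.exp_pos (-(u * x))]

/-- The quadratic Taylor polynomial of `exp (z / 3)` exceeds `z - 1` by exactly `(z / 3 - 2)² / 2`.
-/
theorem abs_one_sub_le_exp_div_three {z : ℝ} (hz : 0 ≤ z) : |1 - z| ≤ Real.exp (z / 3) := by
  have h := Real.quadratic_le_exp_of_nonneg (show 0 ≤ z / 3 by positivity)
  rw [abs_le]
  constructor
  · nlinarith [sq_nonneg (z / 3 - 2)]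
  · nlinarith [sq_nonneg (z / 3)]

/-- Mean value inequality in `z` for `z exp (-zx)`: its derivative `(1 - zx) exp (-zx)` is at most
`exp (-2zx/3)` in absolute value. A decaying exponential thus survives to be averaged. -/
theorem abs_mul_exp_sub_mul_exp_le {u v x : ℝ} (hu : 0 ≤ u) (huv : u ≤ v) (hx : 0 ≤ x) :
    |v * Real.exp (-(v * x)) - u * Real.exp (-(u * x))| ≤
      (v - u) * Real.exp (-(2 / 3 * u * x)) := by
  have hd (z : ℝ) : HasDerivAt (fun z => z * Real.exp (-(z * x)))
      ((1 - z * x) * Real.exp (-(z * x))) z := by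
    refine ((hasDerivAt_id' z).mul (((hasDerivAt_id' z).mul_const x).neg.exp)).congr_deriv ?_
    simp only [Pi.neg_apply]
    ring
  have h := Convex.norm_image_sub_le_of_norm_hasDerivWithin_le 
    (f := fun z => z * Real.exp (-(z * x))) (C := Real.exp (-(2 / 3 * u * x)))
    (fun z _ => (hd z).hasDerivWithinAt) (fun z hz => ?_) (convex_Icc u v) (Set.left_mem_Icc.2 huv)
    (Set.right_mem_Icc.2 huv)
  · rw [Real.norm_eq_abs, Real.norm_eq_abs, abs_of_nonneg (sub_nonneg.2 huv)] at h
    linarith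
  · have hz0 : 0 ≤ z * x := mul_nonneg (hu.trans hz.1) hx
    rw [Real.norm_eq_abs, abs_mul, abs_of_pos (Real.exp_pos _)]
    calc |1 - z * x| * Real.exp (-(z * x)) ≤ Real.exp (z * x / 3) * Real.exp (-(z * x)) := by
          gcongr
          exact abs_one_sub_le_exp_div_three hz0
      _ = Real.exp (-(2 / 3 * (z * x))) := by rw [← Real.exp_add]; ring_nf
      _ ≤ _ := by
          refine Real.exp_le_exp.2 (neg_le_neg ?_)
          rw [mul_assoc]
          have := mul_le_mul_of_nonneg_right hz.1 hx
          linarith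

end ExponentialInequalities

/-! ### Square means and `ℓ¹` bounds for the difference -/

section PoissonDifference

/-- The difference of the characteristic functions of two symmetric compound Poisson laws. -/
noncomputable def poissonDiff (φ : Measure ℤ) (u v t : ℝ) : ℝ :=
  Real.exp (-(u * charExponent φ t)) - Real.exp (-(v * charExponent φ t))

/-- The derivative of `poissonDiff φ u v`. -/
noncomputable def poissonDiffDeriv (φ : Measure ℤ) (u v t : ℝ) : ℝ :=
  charExponentDeriv φ t *
    (v * Real.exp (-(v * charExponent φ t)) - u * Real.exp (-(u * charExponent φ t)))

variable {φ : Measure ℤ}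

theorem hasDerivAt_poissonDiff [IsProbabilityMeasure φ] (h2 : Integrable (fun k : ℤ => (k : ℝ) ^ 2) φ) (u v t : ℝ) :
    HasDerivAt (poissonDiff φ u v) (poissonDiffDeriv φ u v t) t := by
  have h := hasDerivAt_charExponent h2 t
  refine (((h.const_mul u).neg.exp).sub ((h.const_mul v).neg.exp)).congr_deriv ?_
  simp only [poissonDiffDeriv, Pi.neg_apply]
  ring

theorem continuous_poissonDiff [IsProbabilityMeasure φ] (u v : ℝ) : Continuous (poissonDiff φ u v) := by
  have := continuous_charExponent (φ := φ)
  unfold poissonDiff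
  fun_prop

theorem continuous_poissonDiffDeriv [IsProbabilityMeasure φ] (h2 : Integrable (fun k : ℤ => (k : ℝ) ^ 2) φ) (u v : ℝ) :
    Continuous (poissonDiffDeriv φ u v) := by
  have := continuous_charExponent (φ := φ)
  have := continuous_charExponentDeriv h2
  unfold poissonDiffDeriv
  fun_prop

theorem period_average_le {f g : ℝ → ℝ} (hf : Continuous f) (hg : Continuous g)
    (h : ∀ t, f t ≤ g t) : (2 * Real.pi)⁻¹ * ∫ t in -Real.pi..Real.pi, f t ≤
      (2 * Real.pi)⁻¹ * ∫ t in -Real.pi..Real.pi, g t := by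
  have hpi := Real.pi_pos
  gcongr
  exact intervalIntegral.integral_mono (by linarith) (hf.intervalIntegrable _ _)
    (hg.intervalIntegrable _ _) h

theorem period_average_const (c : ℝ) : (2 * Real.pi)⁻¹ * ∫ _ in -Real.pi..Real.pi, c = c := by
  have hpi := Real.pi_pos
  rw [intervalIntegral.integral_const, smul_eq_mul]
  field_simp
  ring

theorem poissonDiff_sq_le {u v : ℝ} (huv : u ≤ v) (t : ℝ) :
    poissonDiff φ u v t ^ 2 ≤
      (v - u) ^ 2 * charExponent φ t ^ 2 * Real.exp (-(2 * u * charExponent φ t)) := by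
  have hx := charExponent_nonneg (φ := φ) t
  have h := pow_le_pow_left₀ (abs_nonneg _) (abs_exp_sub_exp_le huv hx) 2
  rw [sq_abs] at h
  refine h.trans_eq ?_
  rw [mul_pow, mul_pow, ← Real.exp_nat_mul]
  push_cast
  ring_nf

theorem poissonDiffDeriv_sq_le [IsProbabilityMeasure φ] (h2 : Integrable (fun k : ℤ => (k : ℝ) ^ 2) φ)
    (hV : 0 < ∫ k : ℤ, (k : ℝ) ^ 2 ∂φ) {u v : ℝ} (hu : 0 ≤ u) (huv : u ≤ v) (t : ℝ) :
    poissonDiffDeriv φ u v t ^ 2 ≤ 2 * (∫ k : ℤ, (k : ℝ) ^ 2 ∂φ) * (v - u) ^ 2 *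
      charExponent φ t * Real.exp (-(4 / 3 * u * charExponent φ t)) := by
  have hx := charExponent_nonneg (φ := φ) t
  have h := pow_le_pow_left₀ (abs_nonneg _) (abs_mul_exp_sub_mul_exp_le hu huv hx) 2
  rw [sq_abs] at h
  have h3 := charExponentDeriv_sq_le h2 hV t
  rw [poissonDiffDeriv, mul_pow]
  refine (mul_le_mul h3 h (sq_nonneg _) (by positivity)).trans_eq ?_
  rw [mul_pow, ← Real.exp_nat_mul]
  push_cast
  ring_nf

theorem average_poissonDiff_sq_le [IsProbabilityMeasure φ] (h0 : φ {0} = 0) {u v : ℝ} (hu : 0 < u) (huv : u ≤ v) :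
    (2 * Real.pi)⁻¹ * ∫ t in -Real.pi..Real.pi, poissonDiff φ u v t ^ 2 ≤
      0.21 * (v - u) ^ 2 / √u ^ 5 := by
  have hc := continuous_charExponent (φ := φ)
  have hpt (t : ℝ) : poissonDiff φ u v t ^ 2 ≤ (v - u) ^ 2 * (0.36788 / (4 / 5 * u)) ^ 2 *
      Real.exp (-(2 / 5 * u * charExponent φ t)) := by
    have hx := charExponent_nonneg (φ := φ) t
    have h1 := pow_le_pow_left₀ (mul_nonneg hx (Real.exp_pos _).le)
      (mul_exp_neg_mul_le (show 0 < 4 / 5 * u by positivity) (charExponent φ t)) 2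
    refine (poissonDiff_sq_le huv t).trans ?_
    -- Part of the decay absorbs `ψ²`, the rest is averaged. The split `2 = 2 · 4/5 + 2/5` minimises
    -- the resulting constant.
    have h3 : Real.exp (-(2 * u * charExponent φ t)) =
        Real.exp (-(4 / 5 * u * charExponent φ t)) ^ 2 *
          Real.exp (-(2 / 5 * u * charExponent φ t)) := by
      rw [← Real.exp_nat_mul, ← Real.exp_add]
      push_cast
      ring_nf
    rw [h3, ← mul_assoc, mul_assoc _ (_ ^ 2) (_ ^ 2), ← mul_pow]
    gcongr
  refine (period_average_le ((continuous_poissonDiff u v).pow 2) (by fun_prop) hpt).trans ?_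
  rw [intervalIntegral.integral_const_mul, mul_left_comm]
  have h4 := average_exp_neg_charExponent_le h0 (show 0 < 2 / 5 * u by positivity)
  have h5 : √(Real.pi / (8 * (2 / 5 * u))) ≤ 0.991 / √u := by
    rw [Real.sqrt_le_left (by positivity), div_pow, Real.sq_sqrt hu.le,
      div_le_div_iff₀ (by positivity) hu]
    nlinarith [Real.pi_lt_d4]
  have hs : u = √u ^ 2 := (Real.sq_sqrt hu.le).symm
  have hsp : 0 < √u := Real.sqrt_pos.2 hu
  calc _ ≤ (v - u) ^ 2 * (0.36788 / (4 / 5 * u)) ^ 2 * (0.991 / √u) := by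
        gcongr; exact h4.trans h5
    _ = (0.36788 * 5 / 4) ^ 2 * 0.991 * ((v - u) ^ 2 / √u ^ 5) := by
        have : u ^ 2 = √u ^ 4 := by rw [show √u ^ 4 = (√u ^ 2) ^ 2 by ring, ← hs]
        rw [div_pow, mul_pow, this]
        field_simp
    _ ≤ 0.21 * ((v - u) ^ 2 / √u ^ 5) := by gcongr; norm_num
    _ = _ := by ring

theorem average_poissonDiffDeriv_sq_le [IsProbabilityMeasure φ] (h0 : φ {0} = 0)
    (h2 : Integrable (fun k : ℤ => (k : ℝ) ^ 2) φ)
    (hV : 0 < ∫ k : ℤ, (k : ℝ) ^ 2 ∂φ) {u v : ℝ} (hu : 0 < u) (huv : u ≤ v) :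
    (2 * Real.pi)⁻¹ * ∫ t in -Real.pi..Real.pi, poissonDiffDeriv φ u v t ^ 2 ≤
      0.779 * (∫ k : ℤ, (k : ℝ) ^ 2 ∂φ) * (v - u) ^ 2 / √u ^ 3 := by
  have hc := continuous_charExponent (φ := φ)
  set V := ∫ k : ℤ, (k : ℝ) ^ 2 ∂φ with hVdef
  have hpt (t : ℝ) : poissonDiffDeriv φ u v t ^ 2 ≤
      2 * V * (v - u) ^ 2 * (0.36788 / (8 / 9 * u)) *
      Real.exp (-(4 / 9 * u * charExponent φ t)) := by
    have hx := charExponent_nonneg (φ := φ) t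
    have h1 := mul_exp_neg_mul_le (show 0 < 8 / 9 * u by positivity) (charExponent φ t)
    refine (poissonDiffDeriv_sq_le h2 hV hu.le huv t).trans ?_
    -- Here a single factor `ψ` has to be absorbed, and the optimal split is `4/3 = 8/9 + 4/9`.
    have h3 : Real.exp (-(4 / 3 * u * charExponent φ t)) =
        Real.exp (-(8 / 9 * u * charExponent φ t)) *
          Real.exp (-(4 / 9 * u * charExponent φ t)) := by
      rw [← Real.exp_add]
      ring_nf
    rw [h3, ← mul_assoc, mul_assoc _ (charExponent φ t) (Real.exp _)]
    gcongr
  refine (period_average_le ((continuous_poissonDiffDeriv h2 u v).pow 2) (by fun_prop) hpt).trans ?_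
  rw [intervalIntegral.integral_const_mul, mul_left_comm]
  have h4 := average_exp_neg_charExponent_le h0 (show 0 < 4 / 9 * u by positivity)
  have h5 : √(Real.pi / (8 * (4 / 9 * u))) ≤ 0.94 / √u := by
    rw [Real.sqrt_le_left (by positivity), div_pow, Real.sq_sqrt hu.le,
      div_le_div_iff₀ (by positivity) hu]
    nlinarith [Real.pi_lt_d4]
  have hs : u = √u ^ 2 := (Real.sq_sqrt hu.le).symm
  have hsp : 0 < √u := Real.sqrt_pos.2 hu
  calc _ ≤ 2 * V * (v - u) ^ 2 * (0.36788 / (8 / 9 * u)) * (0.94 / √u) := by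
        gcongr; exact h4.trans h5
    _ = 2 * (0.36788 * 9 / 8) * 0.94 * (V * (v - u) ^ 2 / √u ^ 3) := by
        rw [show √u ^ 3 = u * √u by rw [pow_succ, ← hs]]
        field_simp
    _ ≤ 0.779 * (V * (v - u) ^ 2 / √u ^ 3) := by gcongr; norm_num
    _ = _ := by ring

theorem sum_norm_fourierCoeffOn_poissonDiff_le [IsProbabilityMeasure φ] (h2 : Integrable (fun k : ℤ => (k : ℝ) ^ 2) φ)
    (u v : ℝ) {β A B : ℝ} (hβ : 0 < β)
    (hA : (2 * Real.pi)⁻¹ * ∫ t in -Real.pi..Real.pi, poissonDiff φ u v t ^ 2 ≤ A)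
    (hB : (2 * Real.pi)⁻¹ * ∫ t in -Real.pi..Real.pi, poissonDiffDeriv φ u v t ^ 2 ≤ B)
    (hab : -Real.pi < Real.pi) (s : Finset ℤ) :
    ∑ k ∈ s, ‖fourierCoeffOn hab (fun t => (poissonDiff φ u v t : ℂ)) k‖ ≤
      √((1 + Real.pi * β) * (A + B / β ^ 2)) := by
  have hpi := Real.pi_pos
  refine (sum_norm_fourierCoeffOn_le hβ (f' := fun t => (poissonDiffDeriv φ u v t : ℂ))
    (fun x => (hasDerivAt_poissonDiff h2 u v x).ofReal_comp)
    (Complex.continuous_ofReal.comp (continuous_poissonDiffDeriv h2 u v)) ?_ hab s).trans ?_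
  · simp [poissonDiff, charExponent_neg]
  · simp only [Complex.norm_real, Real.norm_eq_abs, sq_abs]
    gcongr

/-- Bound for the `ℓ¹` norm of the difference, for small parameters. -/
theorem sum_norm_fourierCoeffOn_poissonDiff_le_of_small [IsProbabilityMeasure φ]
    (h2 : Integrable (fun k : ℤ => (k : ℝ) ^ 2) φ) (hV : 1 ≤ ∫ k : ℤ, (k : ℝ) ^ 2 ∂φ) {u v : ℝ}
    (hu : 0 < u) (huv : u ≤ v) (hv : v ≤ 0.6) (hab : -Real.pi < Real.pi) (s : Finset ℤ) :
    ∑ k ∈ s, ‖fourierCoeffOn hab (fun t => (poissonDiff φ u v t : ℂ)) k‖ ≤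
      2 * (1.7 * (v - u) / v * √(1 + √(∫ k : ℤ, (k : ℝ) ^ 2 ∂φ))) := by
  set V := ∫ k : ℤ, (k : ℝ) ^ 2 ∂φ with hVdef
  have hV0 : 0 < V := by linarith
  have hpi := Real.pi_pos
  have hv0 : 0 < v := hu.trans_le huv
  have hσ : 0 < √V := Real.sqrt_pos.2 hV0
  have hA : (2 * Real.pi)⁻¹ * ∫ t in -Real.pi..Real.pi, poissonDiff φ u v t ^ 2 ≤
      4 * (v - u) ^ 2 := by
    rw [← period_average_const (4 * (v - u) ^ 2)]
    refine period_average_le ((continuous_poissonDiff u v).pow 2) continuous_const fun t => ?_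
    have hx := charExponent_nonneg (φ := φ) t
    have hx2 := charExponent_le_two (φ := φ) t
    calc _ ≤ _ := poissonDiff_sq_le huv t
      _ ≤ (v - u) ^ 2 * 2 ^ 2 * 1 := by
          gcongr
          rw [Real.exp_le_one_iff, neg_nonpos]
          positivity
      _ = _ := by ring
  have hB : (2 * Real.pi)⁻¹ * ∫ t in -Real.pi..Real.pi, poissonDiffDeriv φ u v t ^ 2 ≤
      4 * V * (v - u) ^ 2 := by
    rw [← period_average_const (4 * V * (v - u) ^ 2)]
    refine period_average_le ((continuous_poissonDiffDeriv h2 u v).pow 2) continuous_const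
      fun t => ?_
    have hx := charExponent_nonneg (φ := φ) t
    have hx2 := charExponent_le_two (φ := φ) t
    calc _ ≤ _ := poissonDiffDeriv_sq_le h2 hV0 hu.le huv t
      _ ≤ 2 * V * (v - u) ^ 2 * 2 * 1 := by
          gcongr
          rw [Real.exp_le_one_iff, neg_nonpos]
          positivity
      _ = _ := by ring
  -- The scale `β = σ` makes the two terms `A` and `B / β²` equal.
  refine (sum_norm_fourierCoeffOn_poissonDiff_le h2 u v hσ hA hB hab s).trans ?_
  have h3 : 4 * (v - u) ^ 2 + 4 * V * (v - u) ^ 2 / √V ^ 2 = 8 * (v - u) ^ 2 := by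
    rw [Real.sq_sqrt hV0.le]
    field_simp
    ring
  have hw : 0 ≤ v - u := sub_nonneg.2 huv
  rw [h3]
  refine Real.sqrt_le_iff.2 ⟨by positivity, ?_⟩
  rw [mul_pow, mul_pow, Real.sq_sqrt (by positivity)]
  have h4 : 1.7 * (v - u) / 0.6 ≤ 1.7 * (v - u) / v := by gcongr
  have h5 : (1 + Real.pi * √V) ≤ 3.1416 * (1 + √V) := by
    nlinarith [Real.pi_lt_d4]
  calc (1 + Real.pi * √V) * (8 * (v - u) ^ 2) ≤ 3.1416 * (1 + √V) * (8 * (v - u) ^ 2) := by gcongr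
    _ ≤ 2 ^ 2 * ((1.7 * (v - u) / 0.6) ^ 2 * (1 + √V)) := by
        have : 0 ≤ (v - u) ^ 2 * (1 + √V) := by positivity
        have h6 : 3.1416 * (1 + √V) * (8 * (v - u) ^ 2) =
            3.1416 * 8 * ((v - u) ^ 2 * (1 + √V)) := by ring
        have h7 : 2 ^ 2 * ((1.7 * (v - u) / 0.6) ^ 2 * (1 + √V)) =
            2 ^ 2 * (1.7 / 0.6) ^ 2 * ((v - u) ^ 2 * (1 + √V)) := by ring
        rw [h6, h7]
        refine mul_le_mul_of_nonneg_right ?_ this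
        norm_num
    _ ≤ _ := by gcongr

/-- Bound for the `ℓ¹` norm of the difference, for comparable parameters away from zero. -/
theorem sum_norm_fourierCoeffOn_poissonDiff_le_of_comparable [IsProbabilityMeasure φ] (h0 : φ {0} = 0)
    (h2 : Integrable (fun k : ℤ => (k : ℝ) ^ 2) φ) (hV : 1 ≤ ∫ k : ℤ, (k : ℝ) ^ 2 ∂φ) {u v : ℝ}
    (huv : u ≤ v) (hv : 0.6 ≤ v) (huv' : 0.58 * v ≤ u) (hab : -Real.pi < Real.pi)
    (s : Finset ℤ) :
    ∑ k ∈ s, ‖fourierCoeffOn hab (fun t => (poissonDiff φ u v t : ℂ)) k‖ ≤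
      2 * (1.7 * (v - u) / v * √(1 + √(∫ k : ℤ, (k : ℝ) ^ 2 ∂φ))) := by
  set V := ∫ k : ℤ, (k : ℝ) ^ 2 ∂φ with hVdef
  have hV0 : 0 < V := by linarith
  have hpi := Real.pi_pos
  have hv0 : 0 < v := by linarith
  have hu : 0 < u := by linarith
  have hσ : 0 < √V := Real.sqrt_pos.2 hV0
  have hρ : 0 < √u := Real.sqrt_pos.2 hu
  have hρ2 : √u ^ 2 = u := Real.sq_sqrt hu.le
  have hρ3 : 0.5 ≤ √u := Real.le_sqrt_of_sq_le (by linarith)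
  have hw : 0 ≤ v - u := sub_nonneg.2 huv
  -- For large `β` the best scale is `√(B / A) ≈ 1.93 σ√u`, rounded here to `2σ√u`. Then `0.21 +
  -- 0.779 / 4 = 0.40475`.
  refine (sum_norm_fourierCoeffOn_poissonDiff_le h2 u v (β := 2 * √V * √u) (by positivity)
    (average_poissonDiff_sq_le h0 hu huv) (average_poissonDiffDeriv_sq_le h0 h2 hV0 hu huv)
    hab s).trans ?_
  have h3 : 0.21 * (v - u) ^ 2 / √u ^ 5 +
      0.779 * V * (v - u) ^ 2 / √u ^ 3 / (2 * √V * √u) ^ 2 =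
      0.40475 * (v - u) ^ 2 / √u ^ 5 := by
    rw [mul_pow, mul_pow, Real.sq_sqrt hV0.le]
    field_simp
    ring
  rw [h3]
  refine Real.sqrt_le_iff.2 ⟨by positivity, ?_⟩
  rw [mul_pow, mul_pow, Real.sq_sqrt (by positivity)]
  have h4 : 1.7 * (v - u) * 0.58 / u ≤ 1.7 * (v - u) / v := by
    rw [div_le_div_iff₀ hu hv0]
    nlinarith [mul_le_mul_of_nonneg_left huv' hw]
  -- The lone `1` is absorbed by `6.2832 √u`, since `√u ≥ 0.5`.
  have h5 : 1 + Real.pi * (2 * √V * √u) ≤ 6.2832 * √u * (1 + √V) := by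
    have h6 : Real.pi * (2 * √V * √u) ≤ 3.1416 * (2 * √V * √u) := by
      gcongr
      exact Real.pi_lt_d4.le
    nlinarith
  calc (1 + Real.pi * (2 * √V * √u)) * (0.40475 * (v - u) ^ 2 / √u ^ 5)
      ≤ 6.2832 * √u * (1 + √V) * (0.40475 * (v - u) ^ 2 / √u ^ 5) := by gcongr
    _ = 6.2832 * 0.40475 * ((v - u) ^ 2 * (1 + √V) / u ^ 2) := by
        rw [show u ^ 2 = √u ^ 4 by rw [show √u ^ 4 = (√u ^ 2) ^ 2 by ring, hρ2]]
        field_simp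
    _ ≤ 2 ^ 2 * (1.7 * 0.58) ^ 2 * ((v - u) ^ 2 * (1 + √V) / u ^ 2) := by
        refine mul_le_mul_of_nonneg_right ?_ (by positivity)
        norm_num
    _ = 2 ^ 2 * ((1.7 * (v - u) * 0.58 / u) ^ 2 * (1 + √V)) := by ring
    _ ≤ _ := by gcongr

end PoissonDifference

/-! ### From Fourier coefficients to total variation on the integers -/

section IntegerLaws

theorem integral_exp_intCast_mul_I {m : ℤ} (hm : m ≠ 0) :
    ∫ t in -Real.pi..Real.pi, Complex.exp (m * t * Complex.I) = 0 := by
  have hc : (m * Complex.I : ℂ) ≠ 0 := mul_ne_zero (by exact_mod_cast hm) Complex.I_ne_zero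
  have h : ∀ t : ℝ, (m * t * Complex.I : ℂ) = m * Complex.I * t := fun t => by ring
  simp_rw [h]
  rw [integral_exp_mul_complex hc, div_eq_zero_iff, sub_eq_zero]
  left
  rw [Complex.exp_eq_exp_iff_exists_int]
  refine ⟨m, ?_⟩
  push_cast
  ring

/-- Fourier inversion for laws on the integers. -/
theorem fourierCoeffOn_integral_exp (N : Measure ℤ) [IsFiniteMeasure N]
    (hab : -Real.pi < Real.pi) (n : ℤ) :
    fourierCoeffOn hab (fun t => ∫ k : ℤ, Complex.exp (k * t * Complex.I) ∂N) n = N.real {n} := by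
  have hpi : (Real.pi : ℂ) ≠ 0 := by exact_mod_cast Real.pi_ne_zero
  have h1 : ∀ t : ℝ, fourier (-n) (t : AddCircle (Real.pi - -Real.pi)) •
      (∫ k : ℤ, Complex.exp (k * t * Complex.I) ∂N) =
      ∫ k : ℤ, Complex.exp ((k - n : ℤ) * t * Complex.I) ∂N := fun t => by
    rw [fourier_coe_apply, smul_eq_mul, ← integral_const_mul]
    congr 1 with k
    rw [← Complex.exp_add]
    congr 1
    push_cast
    field_simp
    ring
  have : IsFiniteMeasure (volume.restrict (Set.uIoc (-Real.pi) Real.pi)) := by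
    rw [Set.uIoc]; infer_instance
  rw [fourierCoeffOn_eq_integral]
  simp_rw [h1]
  rw [intervalIntegral_integral_swap (by
    refine Integrable.of_bound (C := 1) ?_ (Filter.Eventually.of_forall fun p => ?_)
    · refine Measurable.aestronglyMeasurable ?_
      have : Measurable fun k : ℤ => ((k - n : ℤ) : ℂ) := measurable_of_countable _
      unfold Function.uncurry
      fun_prop
    · have : ((p.2 - n : ℤ) * p.1 * Complex.I : ℂ) =
          (((p.2 - n : ℤ) * p.1 : ℝ) : ℂ) * Complex.I := by push_cast; ring
      simp only [Function.uncurry]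
      rw [this, Complex.norm_exp_ofReal_mul_I])]
  -- Orthogonality of characters: after Fubini only the atom at `n` survives.
  have h2 : ∀ k : ℤ, (∫ t in -Real.pi..Real.pi, Complex.exp ((k - n : ℤ) * t * Complex.I)) =
      Set.indicator {n} (fun _ => (2 * Real.pi : ℂ)) k := fun k => by
    by_cases hk : k = n
    · subst hk
      simp
      ring
    · rw [integral_exp_intCast_mul_I (sub_ne_zero.2 hk)]
      simp [hk]
  simp_rw [h2]
  rw [integral_indicator_const _ (measurableSet_singleton n)]
  simp only [Complex.real_smul]
  push_cast
  field_simp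
  ring

theorem summable_real_singleton (N : Measure ℤ) [IsFiniteMeasure N] :
    Summable fun k : ℤ => N.real {k} := by
  refine ENNReal.summable_toReal ?_
  have h := Measure.tsum_indicator_apply_singleton N Set.univ MeasurableSet.univ
  simp only [Set.indicator_univ] at h
  rw [h]
  exact measure_ne_top _ _

/-- The total variation distance of two laws on the integers is at most half the `ℓ¹` distance. -/
theorem abs_real_sub_real_le_of_sum_le {N₁ N₂ : Measure ℤ} [IsProbabilityMeasure N₁]
    [IsProbabilityMeasure N₂] {R : ℝ}
    (h : ∀ s : Finset ℤ, ∑ k ∈ s, |N₁.real {k} - N₂.real {k}| ≤ 2 * R) (B : Set ℤ) :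
    |N₁.real B - N₂.real B| ≤ R := by
  classical
  have hB : MeasurableSet B := (Set.to_countable B).measurableSet
  -- The sign function `±1` of `B` integrates to `2N(B) - 1` against a probability law. Testing
  -- against it rather than the indicator gains the factor `1/2`.
  set e : ℤ → ℝ := fun k => B.indicator (fun _ => (2 : ℝ)) k - 1 with he
  have he1 : ∀ k, |e k| = 1 := fun k => by
    by_cases hk : k ∈ B
    · norm_num [he, hk]
    · simp [he, hk]
  have hN (N : Measure ℤ) [IsProbabilityMeasure N] :
      HasSum (fun k => N.real {k} * e k) (2 * N.real B - 1) := by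
    have hs : Summable fun k => N.real {k} * e k := by
      refine Summable.of_norm_bounded (summable_real_singleton N) fun k => ?_
      rw [norm_mul, Real.norm_eq_abs (e k), he1, mul_one, Real.norm_of_nonneg measureReal_nonneg]
    have h2 := integral_countable (μ := N) (integrable_of_abs_le_const 1 fun k => (he1 k).le)
    simp only [smul_eq_mul] at h2
    have h3 : ∫ k, e k ∂N = 2 * N.real B - 1 := by
      rw [he, integral_sub ((integrable_const _).indicator hB) (integrable_const _),
        integral_indicator_const _ hB]
      simp [mul_comm]
    rw [← h3, h2]
    exact hs.hasSum
  have h4 := (hN N₁).sub (hN N₂)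
  have h5 : ‖(2 * N₁.real B - 1) - (2 * N₂.real B - 1)‖ ≤ 2 * R := by
    refine le_of_tendsto h4.norm (Filter.Eventually.of_forall fun s => ?_)
    refine (norm_sum_le _ _).trans ((Finset.sum_le_sum fun k _ => ?_).trans (h s))
    rw [← sub_mul, norm_mul, Real.norm_eq_abs (e k), he1, mul_one, Real.norm_eq_abs]
  rw [Real.norm_eq_abs, show (2 * N₁.real B - 1) - (2 * N₂.real B - 1) =
    2 * (N₁.real B - N₂.real B) by ring, abs_mul, abs_two] at h5
  linarith

theorem abs_real_sub_real_le_one {X : Type*} [MeasurableSpace X] {N₁ N₂ : Measure X}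
    [IsProbabilityMeasure N₁] [IsProbabilityMeasure N₂] (B : Set X) :
    |N₁.real B - N₂.real B| ≤ 1 := by
  have h1 : N₁.real B ≤ 1 := measureReal_le_one
  have h2 : N₂.real B ≤ 1 := measureReal_le_one
  have h3 : 0 ≤ N₁.real B := measureReal_nonneg
  have h4 : 0 ≤ N₂.real B := measureReal_nonneg
  rw [abs_le]
  constructor <;> linarith

variable {φ : Measure ℤ}

theorem one_le_integral_sq [IsProbabilityMeasure φ] (h0 : φ {0} = 0) (h2 : Integrable (fun k : ℤ => (k : ℝ) ^ 2) φ) :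
    1 ≤ ∫ k : ℤ, (k : ℝ) ^ 2 ∂φ := by
  have hne : ∀ᵐ k ∂φ, k ≠ 0 := by
    rw [ae_iff]
    simpa using h0
  have h := integral_mono_ae (integrable_const (1 : ℝ)) h2 (hne.mono fun k hk => ?_)
  · simpa using h
  · have h3 : 1 ≤ k ^ 2 := by
      have := sq_nonneg k
      have : k ^ 2 ≠ 0 := by simpa using hk
      omega
    dsimp only
    exact_mod_cast h3

theorem abs_real_sub_real_le_of_le [IsProbabilityMeasure φ] (h0 : φ {0} = 0)
    (h2 : Integrable (fun k : ℤ => (k : ℝ) ^ 2) φ) {N₁ N₂ : Measure ℤ} [IsProbabilityMeasure N₁]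
    [IsProbabilityMeasure N₂] {u v : ℝ} (hu : 0 < u) (huv : u ≤ v)
    (h₁ : ∀ t : ℝ, ∫ k : ℤ, Complex.exp (k * t * Complex.I) ∂N₁ =
      (Real.exp (-(u * charExponent φ t)) : ℂ))
    (h₂ : ∀ t : ℝ, ∫ k : ℤ, Complex.exp (k * t * Complex.I) ∂N₂ =
      (Real.exp (-(v * charExponent φ t)) : ℂ)) (B : Set ℤ) :
    |N₁.real B - N₂.real B| ≤ 1.7 * (v - u) / v * √(1 + √(∫ k : ℤ, (k : ℝ) ^ 2 ∂φ)) := by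
  have hV := one_le_integral_sq h0 h2
  set V := ∫ k : ℤ, (k : ℝ) ^ 2 ∂φ with hVdef
  have hpi := Real.pi_pos
  have hab : -Real.pi < Real.pi := by linarith
  have hv : 0 < v := hu.trans_le huv
  have hcoef (k : ℤ) : |N₁.real {k} - N₂.real {k}| =
      ‖fourierCoeffOn hab (fun t => (poissonDiff φ u v t : ℂ)) k‖ := by
    have hc (a : ℝ) : Continuous fun t : ℝ => (Real.exp (-(a * charExponent φ t)) : ℂ) := by
      have := continuous_charExponent (φ := φ)
      fun_prop
    have hfour : Continuous fun t : ℝ => fourier (-k) (t : AddCircle (Real.pi - -Real.pi)) :=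
      (map_continuous _).comp (AddCircle.continuous_mk' _)
    have h3 : fourierCoeffOn hab (fun t => (poissonDiff φ u v t : ℂ)) k =
        (N₁.real {k} - N₂.real {k} : ℝ) := by
      rw [Complex.ofReal_sub, ← fourierCoeffOn_integral_exp N₁ hab,
        ← fourierCoeffOn_integral_exp N₂ hab]
      simp_rw [h₁, h₂]
      rw [fourierCoeffOn_eq_integral, fourierCoeffOn_eq_integral, fourierCoeffOn_eq_integral,
        ← smul_sub, ← intervalIntegral.integral_sub]
      · simp_rw [← smul_sub, poissonDiff, Complex.ofReal_sub]
      · exact (hfour.smul (hc u)).intervalIntegrable _ _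
      · exact (hfour.smul (hc v)).intervalIntegrable _ _
    rw [h3, Complex.norm_real, Real.norm_eq_abs]
  -- A bound of at least `1` is trivial. Otherwise, as `√(1 + σ) ≥ √2 > 1.414`, one gets `1 - u/v <
  -- 1 / (1.7 · 1.414) < 0.42`, which yields `0.58 v ≤ u`.
  by_cases htriv : 1 ≤ 1.7 * (v - u) / v * √(1 + √V)
  · exact (abs_real_sub_real_le_one B).trans htriv
  refine abs_real_sub_real_le_of_sum_le (fun s => ?_) B
  simp_rw [hcoef]
  rcases le_total v 0.6 with hv6 | hv6
  · exact sum_norm_fourierCoeffOn_poissonDiff_le_of_small h2 hV hu huv hv6 hab s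
  · refine sum_norm_fourierCoeffOn_poissonDiff_le_of_comparable h0 h2 hV huv hv6 ?_ hab s
    have h4 : 1.414 ≤ √(1 + √V) := by
      refine Real.le_sqrt_of_sq_le ?_
      have : 1 ≤ √V := Real.le_sqrt_of_sq_le (by linarith)
      norm_num
      linarith
    push Not at htriv
    have hw : 0 ≤ 1.7 * (v - u) / v := div_nonneg (by linarith) hv.le
    have h5 : 1.7 * (v - u) / v * 1.414 < 1 := lt_of_le_of_lt (by gcongr) htriv
    rw [div_mul_eq_mul_div, div_lt_one hv] at h5
    linarith

theorem abs_real_sub_real_le [IsProbabilityMeasure φ] (h0 : φ {0} = 0)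
    (h2 : Integrable (fun k : ℤ => (k : ℝ) ^ 2) φ) {N : ℝ → Measure ℤ}
    (hN : ∀ u, 0 < u → IsProbabilityMeasure (N u))
    (h : ∀ u, 0 < u → ∀ t : ℝ, ∫ k : ℤ, Complex.exp (k * t * Complex.I) ∂(N u) =
      (Real.exp (-(u * charExponent φ t)) : ℂ)) {u v : ℝ} (hu : 0 < u) (hv : 0 < v) (B : Set ℤ) :
    |(N u).real B - (N v).real B| ≤
      1.7 * |v - u| / max u v * √(1 + √(∫ k : ℤ, (k : ℝ) ^ 2 ∂φ)) := by
  have := hN u hu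
  have := hN v hv
  rcases le_total u v with huv | huv
  · rw [abs_of_nonneg (sub_nonneg.2 huv), max_eq_right huv]
    exact abs_real_sub_real_le_of_le h0 h2 hu huv (h u hu) (h v hv) B
  · rw [abs_sub_comm, abs_sub_comm v, abs_of_nonneg (sub_nonneg.2 huv), max_eq_left huv]
    exact abs_real_sub_real_le_of_le h0 h2 hv huv (h v hv) (h u hu) B

theorem integral_sin_eq_zero (hsymm : ∀ k : ℤ, φ {-k} = φ {k}) (t : ℝ) :
    ∫ k : ℤ, Real.sin (k * t) ∂φ = 0 := by
  have h1 : φ.map (fun k : ℤ => -k) = φ := by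
    refine Measure.ext_of_singleton fun k => ?_
    rw [Measure.map_apply (measurable_of_countable _) (measurableSet_singleton k), ← hsymm k]
    congr 1
    ext j
    simp
  have h3 : ∫ k : ℤ, Real.sin (k * t) ∂φ = - ∫ k : ℤ, Real.sin (k * t) ∂φ := by
    conv_lhs => rw [← h1]
    rw [integral_map (measurable_of_countable _).aemeasurable
      (measurable_of_countable _).aestronglyMeasurable, ← integral_neg]
    simp
  linarith

theorem integral_exp_eq_one_sub_charExponent [IsProbabilityMeasure φ] (hsymm : ∀ k : ℤ, φ {-k} = φ {k}) (t : ℝ) :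
    ∫ k : ℤ, Complex.exp (k * t * Complex.I) ∂φ = ((1 - charExponent φ t : ℝ) : ℂ) := by
  have h1 : ∀ k : ℤ, Complex.exp (k * t * Complex.I) =
      (Real.cos (k * t) : ℂ) + (Real.sin (k * t) : ℂ) * Complex.I := fun k => by
    rw [Complex.exp_mul_I]
    push_cast
    rfl
  have hcos : Integrable (fun k : ℤ => Real.cos (k * t)) φ :=
    integrable_of_abs_le_const 1 fun k => Real.abs_cos_le_one _
  have hsin : Integrable (fun k : ℤ => Real.sin (k * t)) φ :=
    integrable_of_abs_le_const 1 fun k => Real.abs_sin_le_one _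
  simp_rw [h1]
  rw [integral_add hcos.ofReal (hsin.ofReal.mul_const _), integral_mul_const, integral_complex_ofReal,
    integral_complex_ofReal, integral_sin_eq_zero hsymm, charExponent,
    integral_sub (integrable_const _) hcos]
  simp

end IntegerLaws

/-! ### Transfer from the integers to a lattice line -/

section LatticeLine

theorem map_convPow {E E' : Type*} [AddMonoid E] [MeasurableSpace E] [MeasurableAdd₂ E]
    [AddMonoid E'] [MeasurableSpace E'] [MeasurableAdd₂ E'] (L : E →+ E') (hL : Measurable L)
    (φ : Measure E) [IsProbabilityMeasure φ] (k : ℕ) :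
    (convPow φ k).map L = convPow (φ.map L) k := by
  induction k with
  | zero => rw [convPow, convPow, Measure.map_dirac' hL, map_zero]
  | succ k ih => rw [convPow, convPow, Measure.map_conv_addMonoidHom L hL, ih]

theorem map_poissonMixture {E E' : Type*} [AddMonoid E] [MeasurableSpace E] [MeasurableAdd₂ E]
    [AddMonoid E'] [MeasurableSpace E'] [MeasurableAdd₂ E'] (L : E →+ E') (hL : Measurable L)
    (φ : Measure E) [IsProbabilityMeasure φ] (l : ℝ) :
    (poissonMixture l φ).map L = poissonMixture l (φ.map L) := by
  unfold poissonMixture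
  rw [Measure.map_sum hL.aemeasurable]
  simp_rw [Measure.map_smul, map_convPow L hL]

variable {E : Type*} [NormedAddCommGroup E] [InnerProductSpace ℝ E] [MeasurableSpace E]
  [BorelSpace E] [SecondCountableTopology E]

/-- The frequency `t y / ‖y‖²` has inner product `kt` with `k y`, so along this direction the
characteristic function is the Fourier series of `N`. -/
theorem charFun_map_zmultiplesHom {y : E} (hy : y ≠ 0) (N : Measure ℤ) (t : ℝ) :
    charFun (N.map (zmultiplesHom E y)) (t • (‖y‖ ^ 2)⁻¹ • y) =
      ∫ k : ℤ, Complex.exp (k * t * Complex.I) ∂N := by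
  have hy' : ‖y‖ ≠ 0 := norm_ne_zero_iff.2 hy
  rw [charFun_apply, integral_map (measurable_of_countable _).aemeasurable (by fun_prop)]
  congr 1 with k
  have h : inner ℝ (zmultiplesHom E y k) (t • (‖y‖ ^ 2)⁻¹ • y) = k * t := by
    rw [zmultiplesHom_apply, ← Int.cast_smul_eq_zsmul ℝ, inner_smul_left, inner_smul_right,
      inner_smul_right, real_inner_self_eq_norm_sq, conj_trivial]
    field_simp
  rw [h]
  push_cast
  rfl

/-- A law carried by the lattice line through `y` is the image of a law on the integers. -/
theorem exists_map_zmultiplesHom_eq {y : E} (hy : y ≠ 0) (G : Measure E) [IsProbabilityMeasure G]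
    (hG : G {x | ∃ k : ℤ, k ≠ 0 ∧ x = k • y}ᶜ = 0) :
    ∃ φ : Measure ℤ, IsProbabilityMeasure φ ∧ φ.map (zmultiplesHom E y) = G ∧ φ {0} = 0 ∧
      ∀ k : ℤ, φ {k} = G {k • y} := by
  have hinj : Function.Injective (zmultiplesHom E y) := fun j k hjk => by
    simp only [zmultiplesHom_apply, ← Int.cast_smul_eq_zsmul ℝ] at hjk
    exact_mod_cast smul_left_injective ℝ hy hjk
  have hemb : MeasurableEmbedding (zmultiplesHom E y) :=
    ⟨hinj, measurable_of_countable _, fun s _ => ((Set.to_countable s).image _).measurableSet⟩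
  have hsub : {x | ∃ k : ℤ, k ≠ 0 ∧ x = k • y} ⊆ Set.range (zmultiplesHom E y) := by
    rintro x ⟨k, -, rfl⟩
    exact ⟨k, rfl⟩
  have hmap : (G.comap (zmultiplesHom E y)).map (zmultiplesHom E y) = G := by
    rw [hemb.map_comap]
    refine Measure.restrict_eq_self_of_ae_mem ?_
    rw [ae_iff]
    exact measure_mono_null (Set.compl_subset_compl.2 hsub) hG
  have hk (k : ℤ) : G.comap (zmultiplesHom E y) {k} = G {k • y} := by
    rw [hemb.comap_apply, Set.image_singleton, zmultiplesHom_apply]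
  refine ⟨_, ⟨?_⟩, hmap, ?_, hk⟩
  · rw [← Set.preimage_univ (f := zmultiplesHom E y),
      ← Measure.map_apply (measurable_of_countable _) MeasurableSet.univ, hmap, measure_univ]
  · rw [hk, zero_smul]
    refine measure_mono_null (Set.singleton_subset_iff.2 ?_) hG
    rintro ⟨k, hk0, hk1⟩
    rw [← Int.cast_smul_eq_zsmul ℝ] at hk1
    rcases smul_eq_zero.1 hk1.symm with h | h
    · exact hk0 (by exact_mod_cast h)
    · exact hy h

/-- The distance between two compound Poisson laws whose compounding law is symmetric and carried
by a lattice line. -/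
theorem exists_abs_poissonMixture_sub_le {y : E} (hy : y ≠ 0) (G : Measure E)
    [IsProbabilityMeasure G] (hG : G {x | ∃ k : ℤ, k ≠ 0 ∧ x = k • y}ᶜ = 0)
    (hsymm : ∀ k : ℤ, 1 ≤ k → G {k • y} = G {(-k) • y}) (hσ : lineSigma G y ≠ ∞) :
    ∃ S : ℝ, 0 ≤ S ∧ (1 + lineSigma G y) ^ (1 / 2 : ℝ) = ENNReal.ofReal S ∧
      ∀ u v : ℝ, 0 < u → 0 < v → ∀ B : Set E, MeasurableSet B →
        |(poissonMixture u G).real B - (poissonMixture v G).real B| ≤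
          1.7 * |v - u| / max u v * S := by
  obtain ⟨φ, hφ, hmap, h0, hk⟩ := exists_map_zmultiplesHom_eq hy G hG
  have hlin : lineSigma G y =
      (∫⁻ k : ℤ, ENNReal.ofReal ((k : ℝ) ^ 2) ∂φ) ^ (1 / 2 : ℝ) := by
    rw [lineSigma, lintegral_countable']
    simp_rw [hk]
  have hfin : ∫⁻ k : ℤ, ENNReal.ofReal ((k : ℝ) ^ 2) ∂φ ≠ ∞ := fun h => by
    rw [hlin, h, ENNReal.top_rpow_of_pos (by norm_num)] at hσ
    exact hσ rfl
  have h2 : Integrable (fun k : ℤ => (k : ℝ) ^ 2) φ :=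
    (lintegral_ofReal_ne_top_iff_integrable (measurable_of_countable _).aestronglyMeasurable
      (Filter.Eventually.of_forall fun k => sq_nonneg _)).1 hfin
  have hlin2 : lineSigma G y = ENNReal.ofReal (√(∫ k : ℤ, (k : ℝ) ^ 2 ∂φ)) := by
    rw [hlin, ← ofReal_integral_eq_lintegral_ofReal h2
      (Filter.Eventually.of_forall fun k => sq_nonneg _), Real.sqrt_eq_rpow,
      ENNReal.ofReal_rpow_of_nonneg (integral_nonneg fun k => sq_nonneg _) (by norm_num)]
  have hsymm' (k : ℤ) : φ {-k} = φ {k} := by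
    rw [hk, hk]
    rcases lt_trichotomy k 0 with h | rfl | h
    · have := hsymm (-k) (by omega)
      rwa [neg_neg] at this
    · simp
    · exact (hsymm k h).symm
  -- Additive maps commute with convolution powers, so the whole comparison can be pulled back to
  -- the integers.
  have hmapP (u : ℝ) : (poissonMixture u φ).map (zmultiplesHom E y) = poissonMixture u G := by
    rw [map_poissonMixture _ (measurable_of_countable _), hmap]
  have hchar (u : ℝ) (hu : 0 < u) (t : ℝ) :
      ∫ k : ℤ, Complex.exp (k * t * Complex.I) ∂(poissonMixture u φ) =
        (Real.exp (-(u * charExponent φ t)) : ℂ) := by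
    rw [← charFun_map_zmultiplesHom hy, hmapP, charFun_poissonMixture hu.le, ← hmap,
      charFun_map_zmultiplesHom hy, integral_exp_eq_one_sub_charExponent hsymm']
    push_cast
    ring_nf
  refine ⟨√(1 + √(∫ k : ℤ, (k : ℝ) ^ 2 ∂φ)), Real.sqrt_nonneg _, ?_, fun u v hu hv B hB => ?_⟩
  · rw [hlin2, ← ENNReal.ofReal_one, ← ENNReal.ofReal_add zero_le_one (Real.sqrt_nonneg _),
      ENNReal.ofReal_rpow_of_nonneg (by positivity) (by norm_num), ← Real.sqrt_eq_rpow]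
  · rw [← hmapP, ← hmapP, map_measureReal_apply (measurable_of_countable _) hB,
      map_measureReal_apply (measurable_of_countable _) hB]
    exact abs_real_sub_real_le h0 h2 (fun u hu => isProbabilityMeasure_poissonMixture hu.le φ)
      hchar hu hv _

end LatticeLine

/-! ### Assembly of the bound -/

theorem theorem12 (d K : ℕ) (hK : d ≤ K)
    (F : Measure (EuclideanSpace ℝ (Fin d))) [IsProbabilityMeasure F]
    (q : ℝ) (hq : q ∈ Set.Ioo (0 : ℝ) 1)
    (p : Fin K → ℝ) (hp : ∀ m, p m ∈ Set.Ioo (0 : ℝ) 1) (hsum : ∑ m, p m = 1 - q)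
    (Fm : Fin K → Measure (EuclideanSpace ℝ (Fin d))) [∀ m, IsProbabilityMeasure (Fm m)]
    (hF : F = ENNReal.ofReal q • Measure.dirac 0 + ∑ m, ENNReal.ofReal (p m) • Fm m)
    (y : Fin K → EuclideanSpace ℝ (Fin d)) (hy : ∀ m, y m ≠ 0)
    (hsupp : ∀ m, (Fm m).support ⊆ {x | ∃ k : ℤ, k ≠ 0 ∧ x = k • y m})
    (hdisj : ∀ m k, k ≠ m → (Fm m).support ∩ (Fm k).support = ∅)
    (hne : ∀ m, (Fm m).support ≠ ∅)
    (hsymm : ∀ m, ∀ k : ℤ, 1 ≤ k → Fm m {k • y m} = Fm m {(-k) • y m})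
    (hspan : ∀ m, ∃ k₀ : ℤ, 0 < Fm m {k₀ • y m} ∧ 0 < Fm m {(k₀ + 1) • y m})
    (a b : ℝ) (ha : 0 < a) (hb : 0 < b) :
    signedTVDist (compoundPoisson a F) (compoundPoisson b F) ≤
      ENNReal.ofReal (1.7 * |b - a| / max a b) *
        ∑ m, (1 + lineSigma (Fm m) (y m)) ^ (1 / 2 : ℝ) := by
  -- The case `a = b` is separated because the right-hand side could then read `0 * ∞`, which is
  -- `0`; the distance vanishes anyway.
  rcases eq_or_ne a b with rfl | hab
  · simp [signedTVDist]
  have hmax : 0 < max a b := lt_max_of_lt_left ha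
  by_cases hσ : ∀ m, lineSigma (Fm m) (y m) ≠ ∞
  · choose S hS0 hS hd using fun m => exists_abs_poissonMixture_sub_le (hy m) (Fm m)
      -- The complement of the topological support is null, so the support inclusion concentrates
      -- the law on the non-zero lattice points.
      (measure_mono_null (Set.compl_subset_compl.2 (hsupp m)) Measure.measure_compl_support)
      (hsymm m) (hσ m)
    have hc : 0 ≤ 1.7 * |b - a| / max a b := by positivity
    simp_rw [hS]
    rw [← ENNReal.ofReal_sum_of_nonneg fun m _ => hS0 m, ← ENNReal.ofReal_mul hc, Finset.mul_sum]
    refine iSup₂_le fun B hB => ENNReal.ofReal_le_ofReal ?_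
    rw [compoundPoisson_apply_eq_poissonMixture ha.le F hB,
      compoundPoisson_apply_eq_poissonMixture hb.le F hB]
    refine abs_poissonMixture_sub_le_sum hq.1.le (fun m => (hp m).1.le) hsum Fm hF ha.le hb.le
      (fun m B hB => ?_) hB
    have hpm := (hp m).1
    have h := hd m (a * p m) (b * p m) (mul_pos ha hpm) (mul_pos hb hpm) B hB
    -- The weight `p m` scales both parameters and cancels from `|v - u| / max u v`.
    rwa [← sub_mul, abs_mul, abs_of_pos hpm, ← max_mul_of_nonneg _ _ hpm.le, ← mul_assoc,
      mul_div_mul_right _ _ hpm.ne'] at h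
  · push Not at hσ
    obtain ⟨m, hm⟩ := hσ
    have h1 : ∑ m, (1 + lineSigma (Fm m) (y m)) ^ (1 / 2 : ℝ) = ∞ := by
      refine ENNReal.sum_eq_top.2 ⟨m, Finset.mem_univ m, ?_⟩
      rw [hm, add_top, ENNReal.top_rpow_of_pos (by norm_num)]
    have h2 : 0 < 1.7 * |b - a| / max a b := by
      have := abs_pos.2 (sub_ne_zero.2 hab.symm)
      positivity
    rw [h1, ENNReal.mul_top (ENNReal.ofReal_pos.2 h2).ne']
    exact le_top
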